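/- Let $d\ge1$ and let $w\in L^1(\mathbb R^d)+L^\infty(\mathbb R^d)$ be a positive, radial and non-increasing function. For a measurable $g:\mathbb R^d\to[0,1]$ with $\int_{\mathbb R^d}g<\infty$ define the no-spin Hartree–Fock energy at temperature $T=0$ by $$\mathcal E(g)=\frac1{2(2\pi)^d}\int_{\mathbb R^d}|k|^2g(k)\,dk-\frac1{2(2\pi)^d}\iint_{\mathbb R^d\times\mathbb R^d}w(k-k')\,g(k)\,g(k')\,dk\,dk'\in(-\infty,+\infty],$$ where the double integral is absolutely convergent. Then, for every $\rho\ge0$, the minimisation problem $$\min\Big\{\mathcal E(g)\ :\ 0\le g\le1,\ \frac1{(2\pi)^d}\int_{\mathbb R^d}g(k)\,dk=\rho\Big\}$$ has a unique minimiser (up to equality almost everywhere), given by $$g(k)=\mathbf 1\big(|k|^2\le c_{TF}\,\rho^{2/d}\big),\qquad c_{TF}=4\pi^2\left(\frac{d}{|\mathbb S^{d-1}|}\right)^{2/d},$$ where $|\mathbb S^{d-1}|$ is the surface area of the unit sphere of $\mathbb R^d$. In particular, the minimiser does not depend on $w$. -/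

import Mathlib

open MeasureTheory

noncomputable section

/-- Membership in `L¹(ℝᵈ) + L^∞(ℝᵈ)`. -/
def MemL1AddLinfty {d : ℕ} (w : EuclideanSpace ℝ (Fin d) → ℝ) : Prop :=
  ∃ w₁ w₂ : EuclideanSpace ℝ (Fin d) → ℝ,
    MemLp w₁ 1 volume ∧ MemLp w₂ ⊤ volume ∧ w =ᵐ[volume] w₁ + w₂

/-- `w` is (almost everywhere equal to) a radial function with non-increasing profile on `(0, ∞)`.
Nothing is asked of the profile at `0`, where a singular potential such as `|k|⁻²` is infinite. -/
def IsRadialNonincreasing {d : ℕ} (w : EuclideanSpace ℝ (Fin d) → ℝ) : Prop :=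
  ∃ φ : ℝ → ℝ, AntitoneOn φ (Set.Ioi 0) ∧ ∀ᵐ k ∂volume, w k = φ ‖k‖

/-- The no-spin states of density `ρ`: `0 ≤ g ≤ 1` (almost everywhere), `(2π)⁻ᵈ ∫ g = ρ`. -/
structure IsNoSpinState {d : ℕ} (ρ : ℝ) (g : EuclideanSpace ℝ (Fin d) → ℝ) : Prop where
  integrable : Integrable g volume
  bounds : ∀ᵐ k ∂volume, 0 ≤ g k ∧ g k ≤ 1
  density : 1 / (2 * Real.pi) ^ d * ∫ k, g k = ρ

/-- The integrand `w (k - k') g(k) g(k')` of the exchange energy, on `ℝᵈ × ℝᵈ`. -/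
def exchangeIntegrand {d : ℕ} (w g : EuclideanSpace ℝ (Fin d) → ℝ)
    (p : EuclideanSpace ℝ (Fin d) × EuclideanSpace ℝ (Fin d)) : ℝ :=
  w (p.1 - p.2) * g p.1 * g p.2

/-- The kinetic energy `(2 (2π)ᵈ)⁻¹ ∫ |k|² g(k) dk ∈ [0, ∞]` of a state `g ≥ 0`. -/
def kineticEnergy {d : ℕ} (g : EuclideanSpace ℝ (Fin d) → ℝ) : ENNReal :=
  ENNReal.ofReal (1 / (2 * (2 * Real.pi) ^ d)) * ∫⁻ k, ENNReal.ofReal (‖k‖ ^ 2 * g k)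

/-- The exchange energy `(2 (2π)ᵈ)⁻¹ ∬ w(k - k') g(k) g(k') dk dk'`. -/
def exchangeEnergy {d : ℕ} (w g : EuclideanSpace ℝ (Fin d) → ℝ) : ℝ :=
  1 / (2 * (2 * Real.pi) ^ d) * ∫ p, exchangeIntegrand w g p

/-- The no-spin Hartree-Fock energy per unit volume at zero temperature, in `(-∞, ∞]`. -/
def noSpinEnergy {d : ℕ} (w g : EuclideanSpace ℝ (Fin d) → ℝ) : EReal :=
  (kineticEnergy g : EReal) - (exchangeEnergy w g : EReal)

/-- `g` minimises the zero-temperature no-spin energy among the states of density `ρ`. -/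
def IsNoSpinMinimiser {d : ℕ} (w : EuclideanSpace ℝ (Fin d) → ℝ) (ρ : ℝ)
    (g : EuclideanSpace ℝ (Fin d) → ℝ) : Prop :=
  IsNoSpinState ρ g ∧
    ∀ f : EuclideanSpace ℝ (Fin d) → ℝ, IsNoSpinState ρ f → noSpinEnergy w g ≤ noSpinEnergy w f

/-- The area `|𝕊ᵈ⁻¹|` of the unit sphere of `ℝᵈ`. -/
def sphereArea (d : ℕ) : ℝ :=
  ((volume : Measure (EuclideanSpace ℝ (Fin d))).toSphere).real Set.univ

/-- The Thomas-Fermi constant `4π² (d / |𝕊ᵈ⁻¹|)^(2/d)`. -/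
def thomasFermiConstant (d : ℕ) : ℝ :=
  4 * Real.pi ^ 2 * ((d : ℝ) / sphereArea d) ^ ((2 : ℝ) / (d : ℝ))

/-- The function `k ↦ 𝟙(k² ≤ c_TF ρ^(2/d))`. -/
def fermiBall (d : ℕ) (ρ : ℝ) : EuclideanSpace ℝ (Fin d) → ℝ :=
  Set.indicator {k | ‖k‖ ^ 2 ≤ thomasFermiConstant d * ρ ^ ((2 : ℝ) / (d : ℝ))} (fun _ => 1)

end

/-! The centred ball is optimal for both terms of the energy at once, which is why `w` plays no role
in the answer. Under the constraints `0 ≤ g ≤ 1` and fixed mass, the bathtub principle says that the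
ball minimises the second moment and is the only minimiser (`ae_eq_indicator_of_moment_le`). Riesz'
rearrangement inequality says that it maximises the exchange integral
(`integral_exchangeIntegrand_le`). Uniqueness comes from the kinetic term alone: no equality case of
Riesz is needed.

Riesz' inequality is proved by polarization and compactness. Take first a bounded non-increasing
kernel and a continuous `f` with compact support. Functions with the modulus of continuity, support
bound, value range and mass bound of `f` form a compact set, stable under polarizations that favour
the side of the origin. On it, maximise the interaction minus `ε` times the second moment. A
polarization does not lower the interaction, and it strictly lowers the moment unless it leaves the
function unchanged, so a maximiser is radially non-increasing. The potential of such a function is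
again radially non-increasing, so the bathtub principle replaces the two factors by the ball, one
after the other. Letting `ε → 0`, approximating in `L¹` and removing a truncation of the kernel give
the general case. -/

section Riesz

/-! ### Reflections in affine hyperplanes. -/

variable {E : Type*} [NormedAddCommGroup E] [InnerProductSpace ℝ E]

/-- The reflection of `z` in the hyperplane `⟪u, z⟫ = c`, where `u` is a unit vector. -/
def hyperplaneReflection (u : E) (c : ℝ) (z : E) : E := z - (2 * (inner ℝ u z - c)) • u

section Reflection

variable {u : E} {c : ℝ}

lemma inner_hyperplaneReflection (hu : ‖u‖ = 1) (z : E) :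
    inner ℝ u (hyperplaneReflection u c z) = 2 * c - inner ℝ u z := by
  simp only [hyperplaneReflection, inner_sub_right, inner_smul_right, real_inner_self_eq_norm_sq, hu]
  ring

lemma hyperplaneReflection_hyperplaneReflection (hu : ‖u‖ = 1) (z : E) :
    hyperplaneReflection u c (hyperplaneReflection u c z) = z := by
  rw [hyperplaneReflection, inner_hyperplaneReflection hu, hyperplaneReflection, sub_sub,
    ← add_smul]
  simp only [sub_eq_self]
  ring_nf
  simp

lemma hyperplaneReflection_of_inner_eq {z : E} (hz : inner ℝ u z = c) :
    hyperplaneReflection u c z = z := by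
  simp [hyperplaneReflection, hz]

/-- All the distance comparisons come from this identity: the sign of the correction says whether
`x` and `y` lie on the same side of the mirror. -/
lemma norm_hyperplaneReflection_sub_sq (hu : ‖u‖ = 1) (x y : E) :
    ‖hyperplaneReflection u c x - y‖ ^ 2 =
      ‖x - y‖ ^ 2 + 4 * (inner ℝ u x - c) * (inner ℝ u y - c) := by
  have h : hyperplaneReflection u c x - y = (x - y) - (2 * (inner ℝ u x - c)) • u := by
    rw [hyperplaneReflection]; abel
  rw [h, norm_sub_sq_real, inner_smul_right, norm_smul, hu, real_inner_comm u (x - y), inner_sub_right,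
    mul_one, Real.norm_eq_abs, sq_abs]
  ring

lemma norm_hyperplaneReflection_sq (hu : ‖u‖ = 1) (x : E) :
    ‖hyperplaneReflection u c x‖ ^ 2 = ‖x‖ ^ 2 - 4 * c * (inner ℝ u x - c) := by
  have := norm_hyperplaneReflection_sub_sq (c := c) hu x 0
  simp only [sub_zero, inner_zero_right] at this
  rw [this]; ring

lemma norm_hyperplaneReflection_sub_hyperplaneReflection (hu : ‖u‖ = 1) (x y : E) :
    ‖hyperplaneReflection u c x - hyperplaneReflection u c y‖ = ‖x - y‖ := by
  rw [← sq_eq_sq₀ (norm_nonneg _) (norm_nonneg _), norm_hyperplaneReflection_sub_sq hu,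
    norm_sub_rev, norm_hyperplaneReflection_sub_sq hu, inner_hyperplaneReflection hu,
    norm_sub_rev]
  ring

lemma norm_sub_hyperplaneReflection (hu : ‖u‖ = 1) (x y : E) :
    ‖x - hyperplaneReflection u c y‖ = ‖hyperplaneReflection u c x - y‖ := by
  rw [← norm_hyperplaneReflection_sub_hyperplaneReflection (c := c) hu x,
    hyperplaneReflection_hyperplaneReflection hu]

lemma norm_sub_le_of_same_side (hu : ‖u‖ = 1) {x y : E}
    (h : 0 ≤ (inner ℝ u x - c) * (inner ℝ u y - c)) :
    ‖x - y‖ ≤ ‖hyperplaneReflection u c x - y‖ := by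
  rw [← sq_le_sq₀ (norm_nonneg _) (norm_nonneg _), norm_hyperplaneReflection_sub_sq hu]
  linarith

lemma norm_sub_le_of_opposite_side (hu : ‖u‖ = 1) {x y : E}
    (h : (inner ℝ u x - c) * (inner ℝ u y - c) ≤ 0) :
    ‖hyperplaneReflection u c x - y‖ ≤ ‖x - y‖ := by
  rw [← sq_le_sq₀ (norm_nonneg _) (norm_nonneg _), norm_hyperplaneReflection_sub_sq hu]
  linarith

lemma norm_lt_norm_hyperplaneReflection (hu : ‖u‖ = 1) (hc : 0 < c) {x : E}
    (h : inner ℝ u x < c) : ‖x‖ < ‖hyperplaneReflection u c x‖ := by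
  rw [← sq_lt_sq₀ (norm_nonneg _) (norm_nonneg _), norm_hyperplaneReflection_sq hu]
  nlinarith

/-- The bisecting hyperplane of two points of different norm. -/
lemma exists_hyperplaneReflection_eq {x y : E} (h : ‖x‖ < ‖y‖) :
    ∃ (u : E) (c : ℝ), ‖u‖ = 1 ∧ 0 < c ∧ inner ℝ u x < c ∧ hyperplaneReflection u c x = y := by
  have hne : y - x ≠ 0 := by
    intro h0
    rw [sub_eq_zero.mp h0] at h
    exact lt_irrefl _ h
  have hn : 0 < ‖y - x‖ := norm_pos_iff.mpr hne
  have hsq : ‖y - x‖ ^ 2 = ‖y‖ ^ 2 - 2 * inner ℝ y x + ‖x‖ ^ 2 := norm_sub_sq_real y x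
  have hin : inner ℝ (‖y - x‖⁻¹ • (y - x)) x - (‖y‖ ^ 2 - ‖x‖ ^ 2) / (2 * ‖y - x‖)
      = - ‖y - x‖ / 2 := by
    rw [real_inner_smul_left, inner_sub_left, real_inner_self_eq_norm_sq]
    field_simp
    linarith
  -- The second witness is the component along `u` of the midpoint of `x` and `y`; it is positive
  -- because `y` is the longer vector.
  refine ⟨‖y - x‖⁻¹ • (y - x), (‖y‖ ^ 2 - ‖x‖ ^ 2) / (2 * ‖y - x‖), ?_, ?_, ?_, ?_⟩
  · rw [norm_smul, norm_inv, norm_norm, inv_mul_cancel₀ hn.ne']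
  · have : ‖x‖ ^ 2 < ‖y‖ ^ 2 := by gcongr
    apply div_pos <;> linarith
  · linarith
  · rw [hyperplaneReflection, hin, smul_smul]
    have : 2 * (-‖y - x‖ / 2) * ‖y - x‖⁻¹ = -1 := by field_simp
    rw [this]; simp

lemma continuous_hyperplaneReflection : Continuous (hyperplaneReflection u c) := by
  unfold hyperplaneReflection; fun_prop

variable [MeasurableSpace E] [BorelSpace E]

lemma measurableEmbedding_hyperplaneReflection (hu : ‖u‖ = 1) :
    MeasurableEmbedding (hyperplaneReflection u c : E → E) :=
  (MeasurableEquiv.ofInvolutive _ (hyperplaneReflection_hyperplaneReflection hu)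
    continuous_hyperplaneReflection.measurable).measurableEmbedding

variable [FiniteDimensional ℝ E]

lemma measurePreserving_hyperplaneReflection (hu : ‖u‖ = 1) :
    MeasurePreserving (hyperplaneReflection u c) (volume : Measure E) volume := by
  -- `Submodule.reflection (ℝ ∙ u)` fixes the line of `u`, so its negative is the reflection in the
  -- orthogonal hyperplane; a translation then moves the mirror to level `c`.
  have h : hyperplaneReflection u c =
      (fun z => z + (2 * c) • u) ∘ fun z => -(Submodule.reflection (ℝ ∙ u) z) := by
    ext z
    simp only [hyperplaneReflection, Function.comp, Submodule.reflection_singleton_apply, hu]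
    simp only [two_smul, mul_sub, sub_smul, mul_smul]
    simp
    module
  rw [h]
  exact (measurePreserving_add_right volume _).comp
    ((Measure.measurePreserving_neg volume).comp (LinearIsometryEquiv.measurePreserving _))

end Reflection
end Riesz

/-! ### Polarization: pointwise properties and the two-point inequality. -/

section Riesz

variable {E : Type*} [NormedAddCommGroup E] [InnerProductSpace ℝ E]

open Classical in
/-- The polarization (two-point rearrangement) of `F` which puts the larger of the values at `x` and
at its mirror image into the half space `⟪u, x⟫ ≤ c`. -/
noncomputable def polarization (u : E) (c : ℝ) (F : E → ℝ) (x : E) : ℝ :=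
  if inner ℝ u x ≤ c then max (F x) (F (hyperplaneReflection u c x))
  else min (F x) (F (hyperplaneReflection u c x))

section Polarization

variable {u : E} {c : ℝ} {F : E → ℝ}

lemma polarization_of_le {x : E} (h : inner ℝ u x ≤ c) :
    polarization u c F x = max (F x) (F (hyperplaneReflection u c x)) := if_pos h

lemma polarization_of_ge {x : E} (h : c ≤ inner ℝ u x) :
    polarization u c F x = min (F x) (F (hyperplaneReflection u c x)) := by
  rcases h.eq_or_lt with h | h
  · rw [polarization_of_le h.ge, hyperplaneReflection_of_inner_eq h.symm]; simp
  · exact if_neg h.not_ge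

lemma polarization_reflection_of_le (hu : ‖u‖ = 1) {x : E} (h : inner ℝ u x ≤ c) :
    polarization u c F (hyperplaneReflection u c x) =
      min (F x) (F (hyperplaneReflection u c x)) := by
  rw [polarization_of_ge, hyperplaneReflection_hyperplaneReflection hu, min_comm]
  rw [inner_hyperplaneReflection hu]; linarith

lemma polarization_reflection_of_ge (hu : ‖u‖ = 1) {x : E} (h : c ≤ inner ℝ u x) :
    polarization u c F (hyperplaneReflection u c x) =
      max (F x) (F (hyperplaneReflection u c x)) := by
  rw [polarization_of_le, hyperplaneReflection_hyperplaneReflection hu, max_comm]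
  rw [inner_hyperplaneReflection hu]; linarith

lemma polarization_add_reflection (hu : ‖u‖ = 1) (x : E) :
    polarization u c F x + polarization u c F (hyperplaneReflection u c x) =
      F x + F (hyperplaneReflection u c x) := by
  rcases le_total (inner ℝ u x) c with h | h
  · rw [polarization_of_le h, polarization_reflection_of_le hu h, max_add_min]
  · rw [polarization_of_ge h, polarization_reflection_of_ge hu h, min_add_max]

lemma polarization_mem {s : Set ℝ} (hF : ∀ x, F x ∈ s) (x : E) : polarization u c F x ∈ s := by
  unfold polarization
  split_ifs
  · rcases max_choice (F x) (F (hyperplaneReflection u c x)) with h | h <;> rw [h] <;> exact hF _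
  · rcases min_choice (F x) (F (hyperplaneReflection u c x)) with h | h <;> rw [h] <;> exact hF _

/-- Since `c > 0`, the origin is on the side that receives the maxima, and reflecting a point of
that side moves it outwards. No mass can therefore leave a centred ball. -/
lemma polarization_eq_zero (hu : ‖u‖ = 1) (hc : 0 < c) {R : ℝ} (h0 : ∀ x, 0 ≤ F x)
    (hF : ∀ x, R < ‖x‖ → F x = 0) {x : E} (hx : R < ‖x‖) : polarization u c F x = 0 := by
  rcases lt_or_ge (inner ℝ u x) c with h | h
  · rw [polarization_of_le h.le, hF _ hx,
      hF _ (hx.trans (norm_lt_norm_hyperplaneReflection hu hc h)), max_self]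
  · rw [polarization_of_ge h, hF _ hx, min_eq_left (h0 _)]

/-- Two points on the same side are compared through the stability of `max` and `min`. For points on
opposite sides, reflecting one of them brings it closer to the other, so the crossed differences
obey the same bound. -/
lemma abs_polarization_sub_le (hu : ‖u‖ = 1) {δ ε : ℝ}
    (hF : ∀ x y, ‖x - y‖ < δ → |F x - F y| ≤ ε) {x y : E} (hxy : ‖x - y‖ < δ) :
    |polarization u c F x - polarization u c F y| ≤ ε := by
  have h1 := hF _ _ hxy
  have h2 := hF (hyperplaneReflection u c x) (hyperplaneReflection u c y)
    (by rwa [norm_hyperplaneReflection_sub_hyperplaneReflection hu])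
  have h3 : (inner ℝ u x - c) * (inner ℝ u y - c) ≤ 0 →
      |F (hyperplaneReflection u c x) - F y| ≤ ε := fun h =>
    hF _ _ ((norm_sub_le_of_opposite_side hu h).trans_lt hxy)
  have h4 : (inner ℝ u x - c) * (inner ℝ u y - c) ≤ 0 →
      |F x - F (hyperplaneReflection u c y)| ≤ ε := fun h =>
    hF _ _ (by
      rw [norm_sub_hyperplaneReflection hu]
      exact (norm_sub_le_of_opposite_side hu h).trans_lt hxy)
  rcases le_total (inner ℝ u x) c with hx | hx <;> rcases le_total (inner ℝ u y) c with hy | hy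
  · rw [polarization_of_le hx, polarization_of_le hy]
    exact (abs_max_sub_max_le_max _ _ _ _).trans (max_le h1 h2)
  · have h : (inner ℝ u x - c) * (inner ℝ u y - c) ≤ 0 :=
      mul_nonpos_of_nonpos_of_nonneg (by linarith) (by linarith)
    rw [polarization_of_le hx, polarization_of_ge hy]
    rcases max_choice (F x) (F (hyperplaneReflection u c x)) with ha | ha <;>
    rcases min_choice (F y) (F (hyperplaneReflection u c y)) with hb | hb <;> rw [ha, hb]
    exacts [h1, h4 h, h3 h, h2]
  · have h : (inner ℝ u x - c) * (inner ℝ u y - c) ≤ 0 :=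
      mul_nonpos_of_nonneg_of_nonpos (by linarith) (by linarith)
    rw [polarization_of_ge hx, polarization_of_le hy]
    rcases min_choice (F x) (F (hyperplaneReflection u c x)) with ha | ha <;>
    rcases max_choice (F y) (F (hyperplaneReflection u c y)) with hb | hb <;> rw [ha, hb]
    exacts [h1, h4 h, h3 h, h2]
  · rw [polarization_of_ge hx, polarization_of_ge hy]
    exact (abs_min_sub_min_le_max _ _ _ _).trans (max_le h1 h2)

/-- The inequality behind the rearrangement inequality, for one orbit of pairs of points. -/
lemma two_point_inequality (hu : ‖u‖ = 1) {x y : E} {ψ : ℝ → ℝ} (hψ : Antitone ψ) (F : E → ℝ) :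
    ψ ‖x - y‖ * F x * F y
      + ψ ‖hyperplaneReflection u c x - y‖ * F (hyperplaneReflection u c x) * F y
      + ψ ‖x - hyperplaneReflection u c y‖ * F x * F (hyperplaneReflection u c y)
      + ψ ‖hyperplaneReflection u c x - hyperplaneReflection u c y‖
        * F (hyperplaneReflection u c x) * F (hyperplaneReflection u c y) ≤
    ψ ‖x - y‖ * polarization u c F x * polarization u c F y
      + ψ ‖hyperplaneReflection u c x - y‖
        * polarization u c F (hyperplaneReflection u c x) * polarization u c F y
      + ψ ‖x - hyperplaneReflection u c y‖
        * polarization u c F x * polarization u c F (hyperplaneReflection u c y)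
      + ψ ‖hyperplaneReflection u c x - hyperplaneReflection u c y‖
        * polarization u c F (hyperplaneReflection u c x)
        * polarization u c F (hyperplaneReflection u c y) := by
  rw [norm_hyperplaneReflection_sub_hyperplaneReflection hu, norm_sub_hyperplaneReflection hu]
  have hA : 0 ≤ (inner ℝ u x - c) * (inner ℝ u y - c) →
      ψ ‖hyperplaneReflection u c x - y‖ ≤ ψ ‖x - y‖ := fun h =>
    hψ (norm_sub_le_of_same_side hu h)
  have hB : (inner ℝ u x - c) * (inner ℝ u y - c) ≤ 0 →
      ψ ‖x - y‖ ≤ ψ ‖hyperplaneReflection u c x - y‖ := fun h =>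
    hψ (norm_sub_le_of_opposite_side hu h)
  have hx := polarization_add_reflection (c := c) (F := F) hu x
  have hy := polarization_add_reflection (c := c) (F := F) hu y
  have hax : inner ℝ u x ≤ c → polarization u c F x - polarization u c F (hyperplaneReflection u c x)
      = |F x - F (hyperplaneReflection u c x)| := fun h => by
    rw [polarization_of_le h, polarization_reflection_of_le hu h, max_sub_min_eq_abs']
  have hbx : c ≤ inner ℝ u x → polarization u c F x - polarization u c F (hyperplaneReflection u c x)
      = -|F x - F (hyperplaneReflection u c x)| := fun h => by
    rw [polarization_of_ge h, polarization_reflection_of_ge hu h, ← max_sub_min_eq_abs', neg_sub]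
  have hay : inner ℝ u y ≤ c → polarization u c F y - polarization u c F (hyperplaneReflection u c y)
      = |F y - F (hyperplaneReflection u c y)| := fun h => by
    rw [polarization_of_le h, polarization_reflection_of_le hu h, max_sub_min_eq_abs']
  have hby : c ≤ inner ℝ u y → polarization u c F y - polarization u c F (hyperplaneReflection u c y)
      = -|F y - F (hyperplaneReflection u c y)| := fun h => by
    rw [polarization_of_ge h, polarization_reflection_of_ge hu h, ← max_sub_min_eq_abs', neg_sub]
  generalize polarization u c F x = a' at *
  generalize polarization u c F y = c' at *
  generalize polarization u c F (hyperplaneReflection u c x) = b' at *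
  generalize polarization u c F (hyperplaneReflection u c y) = d' at *
  generalize ψ ‖x - y‖ = A at *
  generalize ψ ‖hyperplaneReflection u c x - y‖ = B at *
  generalize F (hyperplaneReflection u c x) = b at *
  generalize F (hyperplaneReflection u c y) = d at *
  generalize F x = a at *
  generalize F y = e at *
  -- The orbit sum equals `((A + B)(a + b)(e + d) + (A - B)(a - b)(e - d)) / 2`. Polarization keeps
  -- the sums `a + b` and `e + d`, and gives the product of differences the sign of `A - B` without
  -- changing its absolute value.
  have key : 0 ≤ (A - B) * ((a' - b') * (c' - d') - (a - b) * (e - d)) := by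
    have h1 : (a - b) * (e - d) ≤ |a - b| * |e - d| := by
      rw [← abs_mul]; exact le_abs_self _
    have h2 : -(|a - b| * |e - d|) ≤ (a - b) * (e - d) := by
      rw [← abs_mul]; exact neg_abs_le _
    rcases le_total (inner ℝ u x) c with hxc | hxc <;>
    rcases le_total (inner ℝ u y) c with hyc | hyc
    · rw [hax hxc, hay hyc]
      exact mul_nonneg (sub_nonneg.mpr (hA (mul_nonneg_of_nonpos_of_nonpos
        (by linarith) (by linarith)))) (by linarith)
    · rw [hax hxc, hby hyc]
      exact mul_nonneg_of_nonpos_of_nonpos (sub_nonpos.mpr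
        (hB (mul_nonpos_of_nonpos_of_nonneg (by linarith) (by linarith)))) (by linarith)
    · rw [hbx hxc, hay hyc]
      exact mul_nonneg_of_nonpos_of_nonpos (sub_nonpos.mpr
        (hB (mul_nonpos_of_nonneg_of_nonpos (by linarith) (by linarith)))) (by linarith)
    · rw [hbx hxc, hby hyc]
      exact mul_nonneg (sub_nonneg.mpr (hA (mul_nonneg (by linarith) (by linarith))))
        (by linarith)
  have e1 : a' = (a + b + (a' - b')) / 2 := by linarith
  have e2 : b' = (a + b - (a' - b')) / 2 := by linarith
  have e3 : c' = (e + d + (c' - d')) / 2 := by linarith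
  have e4 : d' = (e + d - (c' - d')) / 2 := by linarith
  generalize a' - b' = p at *
  generalize c' - d' = q at *
  subst e1 e2 e3 e4
  linarith

lemma continuous_polarization (hu : ‖u‖ = 1) {δ : ℝ → ℝ} (hδ : ∀ ε > 0, 0 < δ ε)
    (hF : ∀ ε > 0, ∀ x y, ‖x - y‖ < δ ε → |F x - F y| ≤ ε) :
    Continuous (polarization u c F) := by
  refine Metric.continuous_iff.mpr fun y ε hε => ⟨δ (ε / 2), hδ _ (by positivity), fun x hx => ?_⟩
  rw [dist_eq_norm] at hx
  rw [Real.dist_eq]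
  exact (abs_polarization_sub_le hu (hF (ε / 2) (by positivity)) hx).trans_lt (by linarith)

/-- On the side of the origin the mirror image is farther out and the polarized value is larger; on
the other side both signs flip. -/
lemma norm_sq_mul_nonneg (hu : ‖u‖ = 1) (hc : 0 < c) (x : E) :
    0 ≤ (‖x‖ ^ 2 - ‖hyperplaneReflection u c x‖ ^ 2) * (F x - polarization u c F x) := by
  rw [norm_hyperplaneReflection_sq hu]
  rcases le_total (inner ℝ u x) c with h | h
  · rw [polarization_of_le h]
    have := le_max_left (F x) (F (hyperplaneReflection u c x))
    apply mul_nonneg_of_nonpos_of_nonpos <;> nlinarith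
  · rw [polarization_of_ge h]
    have := min_le_left (F x) (F (hyperplaneReflection u c x))
    apply mul_nonneg <;> nlinarith

end Polarization

/-! ### Effect of polarization on mass, interaction and second moment. -/

variable [FiniteDimensional ℝ E] [MeasurableSpace E] [BorelSpace E]

/-- The interaction `∬ ψ(|x - y|) F(x) G(y) dx dy`. -/
noncomputable def interaction (ψ : ℝ → ℝ) (F G : E → ℝ) : ℝ :=
  ∫ p : E × E, ψ ‖p.1 - p.2‖ * F p.1 * G p.2

lemma integrable_interaction {ψ : ℝ → ℝ} {N : ℝ} (hψ : Antitone ψ) (h0 : ∀ r, 0 ≤ ψ r)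
    (hN : ∀ r, ψ r ≤ N) {F G : E → ℝ} (hF : Integrable F) (hG : Integrable G) :
    Integrable fun p : E × E => ψ ‖p.1 - p.2‖ * F p.1 * G p.2 := by
  simp only [mul_assoc]
  refine (hF.mul_prod hG).bdd_mul (c := N)
    (hψ.measurable.comp (by fun_prop)).aestronglyMeasurable (.of_forall fun p => ?_)
  rw [Real.norm_of_nonneg (h0 _)]
  exact hN _

section

variable {u : E} {c : ℝ}

lemma integral_comp_hyperplaneReflection (hu : ‖u‖ = 1) (f : E → ℝ) :
    ∫ x, f (hyperplaneReflection u c x) = ∫ x, f x :=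
  (measurePreserving_hyperplaneReflection hu).integral_comp
    (measurableEmbedding_hyperplaneReflection hu) f

lemma Integrable.comp_hyperplaneReflection (hu : ‖u‖ = 1) {f : E → ℝ} (hf : Integrable f) :
    Integrable fun x => f (hyperplaneReflection u c x) :=
  (measurePreserving_hyperplaneReflection hu).integrable_comp_of_integrable hf

lemma two_mul_integral_eq (hu : ‖u‖ = 1) {f : E → ℝ} (hf : Integrable f) :
    2 * ∫ x, f x = ∫ x, (f x + f (hyperplaneReflection u c x)) := by
  rw [integral_add hf (Integrable.comp_hyperplaneReflection hu hf),
    integral_comp_hyperplaneReflection hu]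
  ring

/-- Averaging over the independent reflections of the two variables reduces inequalities between
double integrals to inequalities on each orbit. -/
lemma integrable_four_reflections (hu : ‖u‖ = 1) {f : E × E → ℝ} (hf : Integrable f) :
    (Integrable fun p : E × E => f p + f (hyperplaneReflection u c p.1, p.2)
      + f (p.1, hyperplaneReflection u c p.2)
      + f (hyperplaneReflection u c p.1, hyperplaneReflection u c p.2)) ∧
    4 * ∫ p, f p = ∫ p : E × E, (f p + f (hyperplaneReflection u c p.1, p.2)
      + f (p.1, hyperplaneReflection u c p.2)
      + f (hyperplaneReflection u c p.1, hyperplaneReflection u c p.2)) := by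
  have hσ := measurePreserving_hyperplaneReflection (c := c) hu
  have he := measurableEmbedding_hyperplaneReflection (c := c) hu
  have hid := MeasurePreserving.id (volume : Measure E)
  have m1 := hσ.prod hid
  have m2 := hid.prod hσ
  have m3 := hσ.prod hσ
  have i1 : Integrable fun p : E × E => f (hyperplaneReflection u c p.1, p.2) :=
    m1.integrable_comp_of_integrable hf
  have i2 : Integrable fun p : E × E => f (p.1, hyperplaneReflection u c p.2) :=
    m2.integrable_comp_of_integrable hf
  have i3 : Integrable fun p : E × E =>
      f (hyperplaneReflection u c p.1, hyperplaneReflection u c p.2) :=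
    m3.integrable_comp_of_integrable hf
  have j1 : ∫ p : E × E, f (hyperplaneReflection u c p.1, p.2) = ∫ p, f p :=
    m1.integral_comp (he.prodMap .id) f
  have j2 : ∫ p : E × E, f (p.1, hyperplaneReflection u c p.2) = ∫ p, f p :=
    m2.integral_comp (MeasurableEmbedding.id.prodMap he) f
  have j3 : ∫ p : E × E, f (hyperplaneReflection u c p.1, hyperplaneReflection u c p.2)
      = ∫ p, f p := m3.integral_comp (he.prodMap he) f
  have k1 : Integrable fun p : E × E => f p + f (hyperplaneReflection u c p.1, p.2) := hf.add i1
  have k2 : Integrable fun p : E × E => f p + f (hyperplaneReflection u c p.1, p.2)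
      + f (p.1, hyperplaneReflection u c p.2) := k1.add i2
  refine ⟨k2.add i3, ?_⟩
  rw [integral_add k2 i3, integral_add k1 i2, integral_add hf i1, j1, j2, j3]
  ring

variable {F : E → ℝ}

lemma integral_polarization (hu : ‖u‖ = 1) (hF : Integrable F)
    (hP : Integrable (polarization u c F)) : ∫ x, polarization u c F x = ∫ x, F x := by
  have h1 := two_mul_integral_eq (c := c) hu hF
  have h2 := two_mul_integral_eq (c := c) hu hP
  simp only [polarization_add_reflection hu] at h2
  linarith

/-- Polarization increases the interaction. -/
lemma interaction_le_interaction_polarization (hu : ‖u‖ = 1) {ψ : ℝ → ℝ} {N : ℝ}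
    (hψ : Antitone ψ) (h0 : ∀ r, 0 ≤ ψ r) (hN : ∀ r, ψ r ≤ N) (hF : Integrable F)
    (hP : Integrable (polarization u c F)) :
    interaction ψ F F ≤ interaction ψ (polarization u c F) (polarization u c F) := by
  obtain ⟨i1, e1⟩ := integrable_four_reflections (c := c) hu (integrable_interaction hψ h0 hN hF hF)
  obtain ⟨i2, e2⟩ := integrable_four_reflections (c := c) hu (integrable_interaction hψ h0 hN hP hP)
  have := integral_mono i1 i2 fun p => two_point_inequality hu hψ F
  rw [← e1, ← e2] at this
  unfold interaction
  linarith

lemma two_mul_moment_sub_moment (hu : ‖u‖ = 1)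
    (hF : Integrable fun x => ‖x‖ ^ 2 * F x)
    (hP : Integrable fun x => ‖x‖ ^ 2 * polarization u c F x) :
    (Integrable fun x =>
      (‖x‖ ^ 2 - ‖hyperplaneReflection u c x‖ ^ 2) * (F x - polarization u c F x)) ∧
    2 * ((∫ x, ‖x‖ ^ 2 * F x) - ∫ x, ‖x‖ ^ 2 * polarization u c F x) =
      ∫ x, (‖x‖ ^ 2 - ‖hyperplaneReflection u c x‖ ^ 2) * (F x - polarization u c F x) := by
  have heq : ∀ x, (‖x‖ ^ 2 - ‖hyperplaneReflection u c x‖ ^ 2) * (F x - polarization u c F x) =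
      (‖x‖ ^ 2 * F x - ‖x‖ ^ 2 * polarization u c F x) +
      (‖hyperplaneReflection u c x‖ ^ 2 * F (hyperplaneReflection u c x) -
      ‖hyperplaneReflection u c x‖ ^ 2 * polarization u c F (hyperplaneReflection u c x)) := by
    intro x
    linear_combination ‖hyperplaneReflection u c x‖ ^ 2 *
      polarization_add_reflection (c := c) (F := F) hu x
  simp only [heq]
  rw [← integral_sub hF hP]
  exact ⟨(hF.sub hP).add (Integrable.comp_hyperplaneReflection hu (hF.sub hP)),
    two_mul_integral_eq hu (hF.sub hP)⟩

/-- Polarization decreases the second moment, strictly unless it does nothing. -/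
lemma le_of_moment_le_moment_polarization (hu : ‖u‖ = 1) (hc : 0 < c) (hcF : Continuous F)
    (hcP : Continuous (polarization u c F))
    (hF : Integrable fun x => ‖x‖ ^ 2 * F x)
    (hP : Integrable fun x => ‖x‖ ^ 2 * polarization u c F x)
    (hle : ∫ x, ‖x‖ ^ 2 * F x ≤ ∫ x, ‖x‖ ^ 2 * polarization u c F x) {x : E}
    (hx : inner ℝ u x < c) : F (hyperplaneReflection u c x) ≤ F x := by
  obtain ⟨hi, he⟩ := two_mul_moment_sub_moment hu hF hP
  have hpos : (0 : E → ℝ) ≤ fun x =>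
      (‖x‖ ^ 2 - ‖hyperplaneReflection u c x‖ ^ 2) * (F x - polarization u c F x) :=
    fun x => norm_sq_mul_nonneg hu hc x
  have hz := (integral_eq_zero_iff_of_nonneg hpos hi).mp
    (le_antisymm (by linarith) (integral_nonneg hpos))
  have hcr := continuous_hyperplaneReflection (u := u) (c := c)
  -- Continuity turns vanishing almost everywhere into vanishing at the given point `x`.
  have hz' := congrFun ((Continuous.ae_eq_iff_eq volume (by fun_prop) continuous_zero).mp hz) x
  simp only [Pi.zero_apply, mul_eq_zero, sub_eq_zero] at hz'
  rcases hz' with h | h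
  · have := norm_lt_norm_hyperplaneReflection hu hc hx
    have : ‖x‖ ^ 2 < ‖hyperplaneReflection u c x‖ ^ 2 := by gcongr
    linarith
  · rw [h, polarization_of_le hx.le]
    exact le_max_right _ _

end
end Riesz

/-! ### A compact class stable under polarization, and its variational problem. -/

section Riesz

variable {E : Type*} [NormedAddCommGroup E]

/-- Continuous functions with values in `[0, 1]`, supported in a given ball and with a given
modulus of continuity `δ`. -/
def boundedClass (R : ℝ) (δ : ℝ → ℝ) : Set C(E, ℝ) :=
  {F | (∀ x, F x ∈ Set.Icc (0 : ℝ) 1) ∧ (∀ x, R < ‖x‖ → F x = 0) ∧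
    ∀ ε > 0, ∀ x y, ‖x - y‖ < δ ε → |F x - F y| ≤ ε}

/-- Arzelà–Ascoli: the common modulus gives equicontinuity. All the conditions are closed under
pointwise limits, so as plain functions the class is closed in a product of copies of `[0, 1]`,
compact by Tychonoff. -/
lemma isCompact_boundedClass (R : ℝ) {δ : ℝ → ℝ} (hδ : ∀ ε > 0, 0 < δ ε) :
    IsCompact (boundedClass R δ : Set C(E, ℝ)) := by
  refine ArzelaAscoli.isCompact_of_equicontinuous _ ?_ ?_
  · have himage : ContinuousMap.toFun '' (boundedClass R δ : Set C(E, ℝ)) =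
        {f | (∀ x, f x ∈ Set.Icc (0 : ℝ) 1) ∧ (∀ x, R < ‖x‖ → f x = 0) ∧
          ∀ ε > 0, ∀ x y, ‖x - y‖ < δ ε → |f x - f y| ≤ ε} := by
      ext f
      constructor
      · rintro ⟨F, hF, rfl⟩
        exact hF
      · intro hf
        refine ⟨⟨f, Metric.continuous_iff.mpr fun y ε hε =>
          ⟨δ (ε / 2), hδ _ (by positivity), fun x hx => ?_⟩⟩, hf, rfl⟩
        rw [dist_eq_norm] at hx
        rw [Real.dist_eq]
        exact (hf.2.2 (ε / 2) (by positivity) x y hx).trans_lt (by linarith)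
    rw [himage]
    have hclosed : IsClosed {f : E → ℝ | (∀ x, f x ∈ Set.Icc (0 : ℝ) 1) ∧
        (∀ x, R < ‖x‖ → f x = 0) ∧ ∀ ε > 0, ∀ x y, ‖x - y‖ < δ ε → |f x - f y| ≤ ε} := by
      simp only [Set.ofPred_and, Set.ofPred_forall]
      refine .inter ?_ (.inter ?_ ?_)
      · exact isClosed_iInter fun x => isClosed_Icc.preimage (continuous_apply x)
      · exact isClosed_iInter fun x => isClosed_iInter fun _ =>
          isClosed_eq (continuous_apply x) continuous_const
      · exact isClosed_iInter fun ε => isClosed_iInter fun _ => isClosed_iInter fun x =>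
          isClosed_iInter fun y => isClosed_iInter fun _ =>
          isClosed_le ((continuous_apply x).sub (continuous_apply y)).abs continuous_const
    refine (isCompact_univ_pi fun _ : E => isCompact_Icc (a := (0 : ℝ)) (b := 1)).of_isClosed_subset
      hclosed fun f hf => ?_
    exact fun x _ => hf.1 x
  · intro x
    refine Metric.equicontinuousAt_iff.mpr fun ε hε =>
      ⟨δ (ε / 2), hδ _ (by positivity), fun y hy F => ?_⟩
    rw [dist_eq_norm, norm_sub_rev] at hy
    rw [Real.dist_eq]
    exact (F.2.2.2 (ε / 2) (by positivity) x y hy).trans_lt (by linarith)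

lemma norm_le_indicator_of_mem_boundedClass {R : ℝ} {δ : ℝ → ℝ} {F : C(E, ℝ)} (hF : F ∈ boundedClass R δ) (x : E) :
    ‖F x‖ ≤ (Metric.closedBall 0 R).indicator (fun _ => (1 : ℝ)) x := by
  by_cases hx : x ∈ Metric.closedBall 0 R
  · rw [Set.indicator_of_mem hx, Real.norm_of_nonneg (hF.1 x).1]
    exact (hF.1 x).2
  · rw [hF.2.1 x (by simpa using hx), norm_zero]
    exact Set.indicator_nonneg (fun _ _ => zero_le_one) _

lemma hasCompactSupport_of_forall_norm_lt [ProperSpace E] {R : ℝ} {F : E → ℝ} (hF : ∀ x, R < ‖x‖ → F x = 0) :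
    HasCompactSupport F := by
  refine HasCompactSupport.intro (isCompact_closedBall (0 : E) R) fun x hx => hF x ?_
  simpa using hx

variable [InnerProductSpace ℝ E]

/-- Polarization as an operation on a class of continuous functions. -/
lemma exists_polarization_mem_boundedClass {u : E} {c R : ℝ} {δ : ℝ → ℝ} (hu : ‖u‖ = 1)
    (hc : 0 < c) (hδ : ∀ ε > 0, 0 < δ ε) {F : C(E, ℝ)} (hF : F ∈ boundedClass R δ) :
    ∃ G ∈ boundedClass R δ, (G : E → ℝ) = polarization u c F :=
  ⟨⟨polarization u c F, continuous_polarization hu hδ hF.2.2⟩,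
    ⟨polarization_mem hF.1, fun _ => polarization_eq_zero hu hc (fun x => (hF.1 x).1) hF.2.1,
      fun ε hε _ _ => abs_polarization_sub_le hu (hF.2.2 ε hε)⟩, rfl⟩

variable [FiniteDimensional ℝ E] [MeasurableSpace E] [BorelSpace E]

section Continuity

variable {R : ℝ} {δ : ℝ → ℝ}

lemma integrable_of_mem_boundedClass {F : C(E, ℝ)} (hF : F ∈ boundedClass R δ) :
    Integrable (fun x => F x) :=
  F.continuous.integrable_of_hasCompactSupport (hasCompactSupport_of_forall_norm_lt hF.2.1)

lemma integrable_norm_sq_mul_of_mem_boundedClass {F : C(E, ℝ)} (hF : F ∈ boundedClass R δ) :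
    Integrable (fun x => ‖x‖ ^ 2 * F x) :=
  Continuous.integrable_of_hasCompactSupport (by fun_prop)
    (hasCompactSupport_of_forall_norm_lt (R := R) fun x hx => by rw [hF.2.1 x hx, mul_zero])

lemma integrable_indicator_closedBall (R : ℝ) :
    Integrable ((Metric.closedBall (0 : E) R).indicator fun _ => (1 : ℝ)) :=
  (integrable_indicator_iff measurableSet_closedBall).mpr
    (integrableOn_const measure_closedBall_lt_top.ne)

lemma continuousOn_integral_boundedClass :
    ContinuousOn (fun F : C(E, ℝ) => ∫ x, F x) (boundedClass R δ) :=
  continuousOn_of_dominated (fun F _ => F.continuous.aestronglyMeasurable)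
    (fun _ hF => .of_forall fun x => norm_le_indicator_of_mem_boundedClass hF x)
    (integrable_indicator_closedBall R)
    (.of_forall fun x => (continuous_eval_const x).continuousOn)

lemma continuousOn_moment_boundedClass :
    ContinuousOn (fun F : C(E, ℝ) => ∫ x, ‖x‖ ^ 2 * F x) (boundedClass R δ) := by
  refine continuousOn_of_dominated
    (bound := (Metric.closedBall 0 R).indicator fun _ => R ^ 2)
    (fun F _ => Continuous.aestronglyMeasurable (by fun_prop))
    (fun F hF => .of_forall fun x => ?_)
    ((integrable_indicator_iff measurableSet_closedBall).mpr
      (integrableOn_const measure_closedBall_lt_top.ne))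
    (.of_forall fun x => ?_)
  · have h := norm_le_indicator_of_mem_boundedClass hF x
    rw [norm_mul, norm_pow, norm_norm]
    by_cases hx : x ∈ Metric.closedBall 0 R
    · rw [Set.indicator_of_mem hx] at h ⊢
      have hx' : ‖x‖ ≤ R := by simpa using hx
      calc ‖x‖ ^ 2 * ‖F x‖ ≤ R ^ 2 * 1 := by gcongr
        _ = R ^ 2 := mul_one _
    · rw [Set.indicator_of_notMem hx] at h ⊢
      have : ‖F x‖ = 0 := le_antisymm h (norm_nonneg _)
      rw [this, mul_zero]
  · exact (continuous_const.mul (continuous_eval_const x)).continuousOn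

lemma continuousOn_interaction_boundedClass {ψ : ℝ → ℝ} {N : ℝ} (hψ : Antitone ψ)
    (h0 : ∀ r, 0 ≤ ψ r) (hN : ∀ r, ψ r ≤ N) :
    ContinuousOn (fun F : C(E, ℝ) => interaction ψ F F) (boundedClass R δ) := by
  have hb := integrable_indicator_closedBall (E := E) R
  refine continuousOn_of_dominated
    (bound := fun p : E × E => N * ((Metric.closedBall 0 R).indicator (fun _ => (1 : ℝ)) p.1 *
      (Metric.closedBall 0 R).indicator (fun _ => (1 : ℝ)) p.2))
    (fun F hF => (integrable_interaction hψ h0 hN (integrable_of_mem_boundedClass hF)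
      (integrable_of_mem_boundedClass hF)).aestronglyMeasurable)
    (fun F hF => .of_forall fun p => ?_) ((hb.mul_prod hb).const_mul N) (.of_forall fun p => ?_)
  · rw [norm_mul, norm_mul, mul_assoc, Real.norm_of_nonneg (h0 _)]
    have := norm_le_indicator_of_mem_boundedClass hF p.1
    have := norm_le_indicator_of_mem_boundedClass hF p.2
    have hN0 := (h0 0).trans (hN 0)
    gcongr
    · exact hN _
    · exact (norm_nonneg _).trans (norm_le_indicator_of_mem_boundedClass hF p.1)
  · exact ((continuous_const.mul (continuous_eval_const p.1)).mul
      (continuous_eval_const p.2)).continuousOn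

end Continuity

/-- The interaction of a continuous function, minus a small multiple of its second moment, is
bounded by the interaction of a radially non-increasing function. -/
lemma exists_radially_antitone_of_mem_boundedClass {R m ε : ℝ} {δ ψ : ℝ → ℝ} {N : ℝ}
    (hψ : Antitone ψ) (h0 : ∀ r, 0 ≤ ψ r) (hN : ∀ r, ψ r ≤ N) (hδ : ∀ ε > 0, 0 < δ ε)
    (hε : 0 < ε) {f : C(E, ℝ)} (hf : f ∈ boundedClass R δ) (hm : ∫ x, f x ≤ m) :
    ∃ F ∈ boundedClass R δ, ∫ x, F x ≤ m ∧ (∀ x y : E, ‖x‖ < ‖y‖ → F y ≤ F x) ∧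
      interaction ψ f f - ε * ∫ x, ‖x‖ ^ 2 * f x ≤ interaction ψ F F := by
  have hS : IsCompact (boundedClass R δ ∩ {F : C(E, ℝ) | ∫ x, F x ≤ m}) := by
    have hcomp := isCompact_boundedClass (E := E) R hδ
    exact hcomp.of_isClosed_subset (continuousOn_integral_boundedClass.preimage_isClosed_of_isClosed
      hcomp.isClosed isClosed_Iic) Set.inter_subset_left
  -- A maximiser of the interaction alone need not be centred; the penalty by the second moment
  -- forces symmetry about the origin.
  obtain ⟨F, ⟨hF, hFm⟩, hmax⟩ := hS.exists_isMaxOn ⟨f, hf, hm⟩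
    (f := fun F : C(E, ℝ) => interaction ψ F F - ε * ∫ x, ‖x‖ ^ 2 * F x)
    (((continuousOn_interaction_boundedClass hψ h0 hN).sub
      (continuousOn_const.mul continuousOn_moment_boundedClass)).mono Set.inter_subset_left)
  refine ⟨F, hF, hFm, fun x y hxy => ?_, ?_⟩
  -- Polarize in the mirror that exchanges `x` and `y`: by maximality the moment cannot drop, so the
  -- values at these two points are already in order.
  · obtain ⟨u, c, hu, hc, hx, rfl⟩ := exists_hyperplaneReflection_eq hxy
    obtain ⟨G, hG, hGF⟩ := exists_polarization_mem_boundedClass hu hc hδ hF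
    have iF := integrable_of_mem_boundedClass hF
    have iG := integrable_of_mem_boundedClass hG
    have mF := integrable_norm_sq_mul_of_mem_boundedClass hF
    have mG := integrable_norm_sq_mul_of_mem_boundedClass hG
    have cG := G.continuous
    have hle : interaction ψ G G - ε * ∫ x, ‖x‖ ^ 2 * G x ≤
        interaction ψ F F - ε * ∫ x, ‖x‖ ^ 2 * F x := by
      refine hmax ⟨hG, ?_⟩
      rw [hGF] at iG
      simp only [Set.mem_ofPred_eq, hGF]
      rw [integral_polarization hu iF iG]
      exact hFm
    simp only [hGF] at hle iG mG cG
    have hint := interaction_le_interaction_polarization hu hψ h0 hN iF iG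
    refine le_of_moment_le_moment_polarization hu hc F.continuous cG mF mG ?_ hx
    exact le_of_mul_le_mul_left (by linarith) hε
  · have h1 : interaction ψ f f - ε * ∫ x, ‖x‖ ^ 2 * f x ≤
        interaction ψ F F - ε * ∫ x, ‖x‖ ^ 2 * F x := hmax ⟨hf, hm⟩
    have h2 : 0 ≤ ε * ∫ x, ‖x‖ ^ 2 * F x :=
      mul_nonneg hε.le (integral_nonneg fun x => mul_nonneg (sq_nonneg _) (hF.1 x).1)
    linarith

end Riesz

/-! ### The bathtub principle and Riesz' inequality for continuous functions. -/

section Riesz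

variable {E : Type*} [NormedAddCommGroup E]

lemma indicator_closedBall_radially_antitone (R : ℝ) {x y : E} (h : ‖x‖ < ‖y‖) :
    (Metric.closedBall 0 R).indicator (fun _ => (1 : ℝ)) y ≤
      (Metric.closedBall 0 R).indicator (fun _ => (1 : ℝ)) x := by
  by_cases hy : y ∈ Metric.closedBall 0 R
  · have hx : x ∈ Metric.closedBall 0 R := by
      simp only [mem_closedBall_zero_iff] at hy ⊢
      linarith
    rw [Set.indicator_of_mem hx, Set.indicator_of_mem hy]
  · rw [Set.indicator_of_notMem hy]
    exact Set.indicator_nonneg (fun _ _ => zero_le_one) _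

variable [InnerProductSpace ℝ E]
  [FiniteDimensional ℝ E] [MeasurableSpace E] [BorelSpace E]

lemma ae_norm_ne [Nontrivial E] (R : ℝ) : ∀ᵐ x : E, ‖x‖ ≠ R := by
  have h : volume (Metric.sphere (0 : E) R) = 0 := Measure.addHaar_sphere volume 0 R
  filter_upwards [measure_eq_zero_iff_ae_notMem.mp h] with x hx
  simpa using hx

/-- The bathtub principle for a radially non-increasing weight. -/
lemma integral_mul_le_integral_indicator_mul [Nontrivial E] {R : ℝ} (hR : 0 ≤ R) {F Φ : E → ℝ}
    (hF : Integrable F) (hF01 : ∀ᵐ x, 0 ≤ F x ∧ F x ≤ 1)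
    (hFR : ∫ x, F x ≤ volume.real (Metric.closedBall (0 : E) R))
    (hΦ : ∀ x y : E, ‖x‖ < ‖y‖ → Φ y ≤ Φ x) (hΦ0 : ∀ x, 0 ≤ Φ x)
    (hFΦ : Integrable fun x => F x * Φ x)
    (hBΦ : Integrable fun x => (Metric.closedBall 0 R).indicator (fun _ => (1 : ℝ)) x * Φ x) :
    ∫ x, F x * Φ x ≤ ∫ x, (Metric.closedBall 0 R).indicator (fun _ => (1 : ℝ)) x * Φ x := by
  obtain ⟨z, hz⟩ := exists_norm_eq E hR
  have hB := integrable_indicator_closedBall (E := E) R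
  have hBv : ∫ x, (Metric.closedBall (0 : E) R).indicator (fun _ => (1 : ℝ)) x =
      volume.real (Metric.closedBall (0 : E) R) := by
    rw [integral_indicator measurableSet_closedBall]
    simp
  -- The value of `Φ` at a point of norm `R` serves as threshold: off the null sphere, `Φ - Φ z` has
  -- the sign of the ball's indicator minus `F`. As `Φ z ≥ 0`, a mass inequality is enough.
  have hpt : ∀ᵐ x : E,
      Φ z * ((Metric.closedBall 0 R).indicator (fun _ => (1 : ℝ)) x - F x) ≤
      (Metric.closedBall 0 R).indicator (fun _ => (1 : ℝ)) x * Φ x - F x * Φ x := by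
    filter_upwards [hF01, ae_norm_ne R] with x hx hxR
    rcases hxR.lt_or_gt with h | h
    · rw [Set.indicator_of_mem (by simpa using h.le)]
      have := hΦ x z (by rwa [hz])
      nlinarith
    · rw [Set.indicator_of_notMem (by simpa using h)]
      have := hΦ z x (by rwa [hz])
      nlinarith
  have hint := integral_mono_ae ((hB.sub hF).const_mul (Φ z)) (hBΦ.sub hFΦ) hpt
  simp only [Pi.sub_apply] at hint
  rw [integral_const_mul, integral_sub hB hF, integral_sub hBΦ hFΦ, hBv] at hint
  nlinarith [hΦ0 z]

section Potential

variable {ψ : ℝ → ℝ} {N : ℝ}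

lemma integrable_potential (hψ : Antitone ψ) (h0 : ∀ r, 0 ≤ ψ r) (hN : ∀ r, ψ r ≤ N)
    {G : E → ℝ} (hG : Integrable G) (x : E) : Integrable fun y => ψ ‖x - y‖ * G y := by
  refine hG.bdd_mul (c := N)
    (hψ.measurable.comp (by fun_prop)).aestronglyMeasurable (.of_forall fun p => ?_)
  rw [Real.norm_of_nonneg (h0 _)]
  exact hN _

/-- The convolution of radially non-increasing functions is radially non-increasing. -/
lemma potential_radially_antitone (hψ : Antitone ψ) (h0 : ∀ r, 0 ≤ ψ r) (hN : ∀ r, ψ r ≤ N)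
    {G : E → ℝ} (hG : Integrable G) (hGa : ∀ x y : E, ‖x‖ < ‖y‖ → G y ≤ G x) {x x' : E}
    (hx : ‖x‖ < ‖x'‖) : ∫ y, ψ ‖x' - y‖ * G y ≤ ∫ y, ψ ‖x - y‖ * G y := by
  obtain ⟨u, c, hu, hc, hxc, rfl⟩ := exists_hyperplaneReflection_eq hx
  have i1 := integrable_potential hψ h0 hN hG x
  have i2 := integrable_potential hψ h0 hN hG (hyperplaneReflection u c x)
  have h := two_mul_integral_eq (c := c) hu (i1.sub i2)
  have hnonneg : 0 ≤ 2 * ∫ y, (ψ ‖x - y‖ * G y - ψ ‖hyperplaneReflection u c x - y‖ * G y) := by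
    simp only [Pi.sub_apply] at h
    rw [h]
    refine integral_nonneg fun y => ?_
    simp only [Pi.zero_apply, norm_hyperplaneReflection_sub_hyperplaneReflection hu,
      norm_sub_hyperplaneReflection hu]
    -- Adding the contributions of `y` and of its mirror image gives this product, whose factors
    -- have the same sign on each side of the mirror.
    have hfactor : 0 ≤ (ψ ‖x - y‖ - ψ ‖hyperplaneReflection u c x - y‖) *
        (G y - G (hyperplaneReflection u c y)) := by
      rcases lt_trichotomy (inner ℝ u y) c with hy | hy | hy
      · refine mul_nonneg (sub_nonneg.mpr (hψ (norm_sub_le_of_same_side hu ?_)))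
          (sub_nonneg.mpr (hGa _ _ (norm_lt_norm_hyperplaneReflection hu hc hy)))
        exact mul_nonneg_of_nonpos_of_nonpos (by linarith) (by linarith)
      · rw [hyperplaneReflection_of_inner_eq hy]
        simp
      · have hy' : inner ℝ u (hyperplaneReflection u c y) < c := by
          rw [inner_hyperplaneReflection hu]; linarith
        have hlt := norm_lt_norm_hyperplaneReflection hu hc hy'
        rw [hyperplaneReflection_hyperplaneReflection hu] at hlt
        refine mul_nonneg_of_nonpos_of_nonpos
          (sub_nonpos.mpr (hψ (norm_sub_le_of_opposite_side hu ?_))) (sub_nonpos.mpr (hGa _ _ hlt))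
        exact mul_nonpos_of_nonpos_of_nonneg (by linarith) (by linarith)
    linarith
  rw [integral_sub i1 i2] at hnonneg
  linarith

lemma interaction_eq_integral_mul (hψ : Antitone ψ) (h0 : ∀ r, 0 ≤ ψ r) (hN : ∀ r, ψ r ≤ N)
    {F G : E → ℝ} (hF : Integrable F) (hG : Integrable G) :
    (Integrable fun x => F x * ∫ y, ψ ‖x - y‖ * G y) ∧
      interaction ψ F G = ∫ x, F x * ∫ y, ψ ‖x - y‖ * G y := by
  have hi := integrable_interaction hψ h0 hN hF hG
  have heq : ∀ x, ∫ y, ψ ‖x - y‖ * F x * G y = F x * ∫ y, ψ ‖x - y‖ * G y := fun x => by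
    rw [← integral_const_mul]
    congr 1
    ext y
    ring
  refine ⟨?_, ?_⟩
  · have := Integrable.integral_prod_left hi
    simpa only [heq] using this
  · have := integral_prod _ hi
    simp only [heq] at this
    exact this

lemma interaction_comm (ψ : ℝ → ℝ) (F G : E → ℝ) : interaction ψ F G = interaction ψ G F := by
  unfold interaction
  rw [Measure.volume_eq_prod, ← integral_prod_swap]
  congr 1
  ext p
  simp only [Prod.fst_swap, Prod.snd_swap, norm_sub_rev p.2 p.1]
  ring

lemma interaction_le_interaction_indicator_left [Nontrivial E] (hψ : Antitone ψ)
    (h0 : ∀ r, 0 ≤ ψ r) (hN : ∀ r, ψ r ≤ N) {R : ℝ} (hR : 0 ≤ R) {F G : E → ℝ}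
    (hF : Integrable F) (hF01 : ∀ᵐ x, 0 ≤ F x ∧ F x ≤ 1)
    (hFR : ∫ x, F x ≤ volume.real (Metric.closedBall (0 : E) R))
    (hG : Integrable G) (hG0 : ∀ x, 0 ≤ G x) (hGa : ∀ x y : E, ‖x‖ < ‖y‖ → G y ≤ G x) :
    interaction ψ F G ≤
      interaction ψ ((Metric.closedBall 0 R).indicator fun _ => (1 : ℝ)) G := by
  obtain ⟨i1, e1⟩ := interaction_eq_integral_mul hψ h0 hN hF hG
  obtain ⟨i2, e2⟩ := interaction_eq_integral_mul hψ h0 hN (integrable_indicator_closedBall R) hG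
  rw [e1, e2]
  exact integral_mul_le_integral_indicator_mul hR hF hF01 hFR
    (fun x y hxy => potential_radially_antitone hψ h0 hN hG hGa hxy)
    (fun x => integral_nonneg fun y => mul_nonneg (h0 _) (hG0 y)) i1 i2

/-- Riesz' rearrangement inequality for a ball, for continuous compactly supported functions. -/
lemma interaction_le_of_continuous [Nontrivial E] (hψ : Antitone ψ)
    (h0 : ∀ r, 0 ≤ ψ r) (hN : ∀ r, ψ r ≤ N) {R : ℝ} (hR : 0 ≤ R) {f : E → ℝ}
    (hf : Continuous f) (hfs : HasCompactSupport f) (hf01 : ∀ x, 0 ≤ f x ∧ f x ≤ 1)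
    (hfR : ∫ x, f x ≤ volume.real (Metric.closedBall (0 : E) R)) :
    interaction ψ f f ≤ interaction ψ ((Metric.closedBall (0 : E) R).indicator fun _ => (1 : ℝ))
      ((Metric.closedBall (0 : E) R).indicator fun _ => (1 : ℝ)) := by
  have huc := Metric.uniformContinuous_iff.mp (hfs.uniformContinuous_of_continuous hf)
  -- The class is built from the modulus of continuity of `f` itself.
  choose! δ hδ hfδ using huc
  obtain ⟨r, hr⟩ := hfs.isCompact.isBounded.subset_closedBall 0
  have hmem : (⟨f, hf⟩ : C(E, ℝ)) ∈ boundedClass r δ := by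
    refine ⟨hf01, fun x hx => ?_, fun ε hε x y hxy => ?_⟩
    · refine image_eq_zero_of_notMem_tsupport fun hx' => ?_
      have := hr hx'
      rw [mem_closedBall_zero_iff] at this
      linarith
    · have : dist (f x) (f y) < ε := hfδ ε hε (by rwa [dist_eq_norm])
      rw [Real.dist_eq] at this
      exact this.le
  have key : ∀ ε > 0, interaction ψ f f - ε * ∫ x, ‖x‖ ^ 2 * f x ≤
      interaction ψ ((Metric.closedBall (0 : E) R).indicator fun _ => (1 : ℝ))
        ((Metric.closedBall (0 : E) R).indicator fun _ => (1 : ℝ)) := by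
    intro ε hε
    obtain ⟨F, hF, hFm, hFa, hle⟩ :=
      exists_radially_antitone_of_mem_boundedClass hψ h0 hN hδ hε hmem hfR
    have iF := integrable_of_mem_boundedClass hF
    have hF01 : ∀ᵐ x, 0 ≤ F x ∧ F x ≤ 1 := .of_forall hF.1
    have h1 := interaction_le_interaction_indicator_left hψ h0 hN hR iF hF01 hFm iF
      (fun x => (hF.1 x).1) hFa
    have h2 := interaction_le_interaction_indicator_left hψ h0 hN hR iF hF01 hFm
      (integrable_indicator_closedBall R) (fun x => Set.indicator_nonneg (fun _ _ => zero_le_one) _)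
      (fun x y => indicator_closedBall_radially_antitone R)
    rw [interaction_comm] at h2
    exact hle.trans (h1.trans h2)
  have hlim : Filter.Tendsto (fun ε : ℝ => interaction ψ f f - ε * ∫ x, ‖x‖ ^ 2 * f x)
      (nhdsWithin 0 (Set.Ioi 0)) (nhds (interaction ψ f f)) := by
    have : Continuous fun ε : ℝ => interaction ψ f f - ε * ∫ x, ‖x‖ ^ 2 * f x := by fun_prop
    simpa using (this.tendsto 0).mono_left nhdsWithin_le_nhds
  exact le_of_tendsto hlim (eventually_nhdsWithin_of_forall key)

end Potential

end Riesz

/-! ### From continuous to integrable functions. -/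

section Riesz

variable {E : Type*} [NormedAddCommGroup E] [InnerProductSpace ℝ E]
  [FiniteDimensional ℝ E] [MeasurableSpace E] [BorelSpace E]

/-- Functions with values in `[0, 1]` are approximated in `L¹` by continuous compactly supported
functions with values in `[0, 1]`. -/
lemma exists_continuous_integral_abs_sub_le {f : E → ℝ} (hf : Integrable f)
    (hf01 : ∀ᵐ x, 0 ≤ f x ∧ f x ≤ 1) {ε : ℝ} (hε : 0 < ε) :
    ∃ g : E → ℝ, Continuous g ∧ HasCompactSupport g ∧ (∀ x, 0 ≤ g x ∧ g x ≤ 1) ∧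
      ∫ x, |f x - g x| ≤ ε := by
  obtain ⟨g, hgs, hfg, hgc, hgi⟩ := hf.exists_hasCompactSupport_integral_sub_le hε
  have hs : HasCompactSupport fun x => max 0 (min (g x) 1) :=
    hgs.comp_left (g := fun t : ℝ => max 0 (min t 1)) (by simp)
  have hc : Continuous fun x => max 0 (min (g x) 1) := by fun_prop
  refine ⟨fun x => max 0 (min (g x) 1), hc, hs,
    fun x => ⟨le_max_left _ _, max_le zero_le_one (min_le_right _ _)⟩, le_trans ?_ hfg⟩
  refine integral_mono_ae (hf.sub (hc.integrable_of_hasCompactSupport hs)).abs (hf.sub hgi).norm ?_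
  filter_upwards [hf01] with x hx
  simp only [Real.norm_eq_abs]
  calc |f x - max 0 (min (g x) 1)| = |max (min (f x) 1) 0 - max (min (g x) 1) 0| := by
        rw [max_comm 0, max_eq_left (le_min hx.1 zero_le_one), min_eq_left hx.2]
    _ ≤ |min (f x) 1 - min (g x) 1| := abs_max_sub_max_le_abs _ _ _
    _ ≤ max |f x - g x| |(1 : ℝ) - 1| := abs_min_sub_min_le_max _ _ _ _
    _ = |f x - g x| := by simp

/-- Telescoping `f ⊗ f - g ⊗ g = f ⊗ (f - g) + (f - g) ⊗ g` against a kernel bounded by `N`; this is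
the `L¹` stability that the approximation needs. -/
lemma interaction_le_interaction_add {ψ : ℝ → ℝ} {N : ℝ} (hψ : Antitone ψ)
    (h0 : ∀ r, 0 ≤ ψ r) (hN : ∀ r, ψ r ≤ N) {f g : E → ℝ} (hf : Integrable f) (hg : Integrable g)
    (hf0 : ∀ᵐ x, 0 ≤ f x) (hg0 : ∀ x, 0 ≤ g x) :
    interaction ψ f f ≤ interaction ψ g g +
      N * (∫ x, |f x - g x|) * ((∫ x, f x) + ∫ x, g x) := by
  have hd : Integrable fun x => |f x - g x| := (hf.sub hg).abs
  have i1 := integrable_interaction hψ h0 hN hf hf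
  have i2 := integrable_interaction hψ h0 hN hg hg
  have i3 : Integrable fun p : E × E => f p.1 * |f p.2 - g p.2| := hf.mul_prod hd
  have i4 : Integrable fun p : E × E => |f p.1 - g p.1| * g p.2 := hd.mul_prod hg
  have i5 : Integrable fun p : E × E =>
    N * (f p.1 * |f p.2 - g p.2| + |f p.1 - g p.1| * g p.2) := (i3.add i4).const_mul N
  have hf0' : ∀ᵐ p : E × E, 0 ≤ f p.1 := Measure.quasiMeasurePreserving_fst.ae hf0
  have hle : ∀ᵐ p : E × E, ψ ‖p.1 - p.2‖ * f p.1 * f p.2 ≤ ψ ‖p.1 - p.2‖ * g p.1 * g p.2 +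
      N * (f p.1 * |f p.2 - g p.2| + |f p.1 - g p.1| * g p.2) := by
    filter_upwards [hf0'] with p hp
    have h1 : f p.1 * (f p.2 - g p.2) ≤ f p.1 * |f p.2 - g p.2| :=
      mul_le_mul_of_nonneg_left (le_abs_self _) hp
    have h2 : (f p.1 - g p.1) * g p.2 ≤ |f p.1 - g p.1| * g p.2 :=
      mul_le_mul_of_nonneg_right (le_abs_self _) (hg0 _)
    have h3 : 0 ≤ f p.1 * |f p.2 - g p.2| + |f p.1 - g p.1| * g p.2 :=
      add_nonneg (mul_nonneg hp (abs_nonneg _)) (mul_nonneg (abs_nonneg _) (hg0 _))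
    have h4 := mul_le_mul_of_nonneg_left (add_le_add h1 h2) (h0 ‖p.1 - p.2‖)
    have h5 := mul_le_mul_of_nonneg_right (hN ‖p.1 - p.2‖) h3
    linarith
  have h := integral_mono_ae i1 (i2.add i5) hle
  have e1 : ∫ p : E × E, f p.1 * |f p.2 - g p.2| = (∫ x, f x) * ∫ x, |f x - g x| :=
    integral_prod_mul f fun x => |f x - g x|
  have e2 : ∫ p : E × E, |f p.1 - g p.1| * g p.2 = (∫ x, |f x - g x|) * ∫ x, g x :=
    integral_prod_mul (fun x => |f x - g x|) g
  simp only [Pi.add_apply] at h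
  rw [integral_add i2 i5, integral_const_mul, integral_add i3 i4, e1, e2] at h
  unfold interaction
  linarith

/-- Riesz' rearrangement inequality for a ball and a bounded kernel. -/
lemma interaction_le_interaction_indicator [Nontrivial E] {ψ : ℝ → ℝ} {N : ℝ} (hψ : Antitone ψ)
    (h0 : ∀ r, 0 ≤ ψ r) (hN : ∀ r, ψ r ≤ N) {R : ℝ} (hR : 0 ≤ R) {f : E → ℝ}
    (hf : Integrable f) (hf01 : ∀ᵐ x, 0 ≤ f x ∧ f x ≤ 1)
    (hfR : ∫ x, f x ≤ volume.real (Metric.closedBall (0 : E) R)) :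
    interaction ψ f f ≤ interaction ψ ((Metric.closedBall (0 : E) R).indicator fun _ => (1 : ℝ))
      ((Metric.closedBall (0 : E) R).indicator fun _ => (1 : ℝ)) := by
  have hf0 : ∀ᵐ x, 0 ≤ f x := hf01.mono fun x hx => hx.1
  set m := volume.real (Metric.closedBall (0 : E) R) with hm
  set B := (Metric.closedBall (0 : E) R).indicator fun _ => (1 : ℝ) with hB
  have hB0 : ∀ x, 0 ≤ B x := fun x => Set.indicator_nonneg (fun _ _ => zero_le_one) _
  have hfi0 : 0 ≤ ∫ x, f x := integral_nonneg_of_ae hf0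
  have hN0 : 0 ≤ N := (h0 0).trans (hN 0)
  -- A null ball forces `f = 0` almost everywhere; it is treated apart because the rescaling below
  -- divides by `m`.
  rcases (measureReal_nonneg (μ := volume) (s := Metric.closedBall (0 : E) R)).eq_or_lt with h | hpos
  · have hz : ∫ x, f x = 0 := le_antisymm (hfR.trans_eq h.symm) hfi0
    have hz' := (integral_eq_zero_iff_of_nonneg_ae hf0 hf).mp hz
    have hle := interaction_le_interaction_add hψ h0 hN hf (integrable_zero E ℝ volume) hf0
      fun _ => le_rfl
    have e1 : ∫ x : E, |f x - (0 : E → ℝ) x| = 0 := by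
      rw [← integral_zero E ℝ]
      refine integral_congr_ae (hz'.mono fun x hx => ?_)
      simp only [Pi.zero_apply] at hx ⊢
      simp [hx]
    have e2 : interaction ψ (0 : E → ℝ) 0 = 0 := by simp [interaction]
    rw [e1, e2] at hle
    have e3 : 0 ≤ interaction ψ B B :=
      integral_nonneg fun p => mul_nonneg (mul_nonneg (h0 _) (hB0 _)) (hB0 _)
    linarith
  rw [← hm] at hpos
  have key : ∀ ε > 0, interaction ψ f f ≤
      ((m + ε) / m) ^ 2 * interaction ψ B B + N * ε * (2 * m + ε) := by
    intro ε hε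
    obtain ⟨g, hgc, hgs, hg01, hfg⟩ := exists_continuous_integral_abs_sub_le hf hf01 hε
    have hgi := hgc.integrable_of_hasCompactSupport (μ := volume) hgs
    have hgm : ∫ x, g x ≤ m + ε := by
      have h1 : (∫ x, g x) - ∫ x, f x ≤ ∫ x, |f x - g x| := by
        rw [← integral_sub hgi hf]
        refine integral_mono (hgi.sub hf) (hf.sub hgi).abs fun x => ?_
        rw [← neg_sub]
        exact neg_le_abs _
      linarith
    have hmε : 0 < m + ε := by linarith
    have hd0 : 0 ≤ ∫ x, |f x - g x| := integral_nonneg fun _ => abs_nonneg _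
    have ht1 : m / (m + ε) ≤ 1 := (div_le_one hmε).mpr (by linarith)
    have ht0 : 0 ≤ m / (m + ε) := by positivity
    -- The approximant may have mass up to `m + ε`; the factor `m / (m + ε)` restores the mass bound
    -- and keeps the values in `[0, 1]`.
    have hscale := interaction_le_of_continuous (f := fun x => m / (m + ε) * g x) hψ h0 hN hR
      (by fun_prop) hgs.mul_left
      (fun x => ⟨mul_nonneg ht0 (hg01 x).1, mul_le_one₀ ht1 (hg01 x).1 (hg01 x).2⟩) (by
        rw [integral_const_mul, ← hm]
        calc m / (m + ε) * ∫ x, g x ≤ m / (m + ε) * (m + ε) := by gcongr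
          _ = m := div_mul_cancel₀ _ hmε.ne')
    have e1 : interaction ψ (fun x => m / (m + ε) * g x) (fun x => m / (m + ε) * g x) =
        (m / (m + ε)) ^ 2 * interaction ψ g g := by
      unfold interaction
      rw [← integral_const_mul]
      congr 1
      ext p
      ring
    rw [e1, ← hB] at hscale
    have h2 : interaction ψ g g ≤ ((m + ε) / m) ^ 2 * interaction ψ B B := by
      have : interaction ψ g g =
          ((m + ε) / m) ^ 2 * ((m / (m + ε)) ^ 2 * interaction ψ g g) := by
        field_simp
      rw [this]
      gcongr
    have h3 := interaction_le_interaction_add hψ h0 hN hf hgi hf0 fun x => (hg01 x).1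
    have hg0 : 0 ≤ ∫ x, g x := integral_nonneg fun x => (hg01 x).1
    have h4 : N * (∫ x, |f x - g x|) * ((∫ x, f x) + ∫ x, g x) ≤ N * ε * (2 * m + ε) := by
      exact mul_le_mul (by gcongr) (by linarith) (by linarith) (by positivity)
    linarith
  have hlim : Filter.Tendsto
      (fun ε : ℝ => ((m + ε) / m) ^ 2 * interaction ψ B B + N * ε * (2 * m + ε))
      (nhdsWithin 0 (Set.Ioi 0)) (nhds (interaction ψ B B)) := by
    have : Continuous fun ε : ℝ =>
      ((m + ε) / m) ^ 2 * interaction ψ B B + N * ε * (2 * m + ε) := by fun_prop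
    have h := (this.tendsto 0).mono_left (nhdsWithin_le_nhds (s := Set.Ioi 0))
    simpa [div_self hpos.ne'] using h
  exact ge_of_tendsto hlim (eventually_nhdsWithin_of_forall key)

end Riesz

/-! ### The exchange energy: integrability and unbounded kernels. -/

section Exchange

variable {d : ℕ} {w : EuclideanSpace ℝ (Fin d) → ℝ}

/-- The `L¹` part of `w` is handled as a convolution with `g`, times the bounded factor `g`; the
`L^∞` part is a bounded multiple of `g ⊗ g`. -/
lemma integrable_exchangeIntegrand (hw : MemL1AddLinfty w) {g : EuclideanSpace ℝ (Fin d) → ℝ}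
    (hg : Integrable g) (hg01 : ∀ᵐ k, 0 ≤ g k ∧ g k ≤ 1) :
    Integrable (exchangeIntegrand w g) := by
  obtain ⟨w₁, w₂, h₁, h₂, hsum⟩ := hw
  rw [memLp_one_iff_integrable] at h₁
  have hq := quasiMeasurePreserving_sub_of_right_invariant
    (volume : Measure (EuclideanSpace ℝ (Fin d))) volume
  have hfst := Measure.quasiMeasurePreserving_fst (μ := (volume : Measure (EuclideanSpace ℝ (Fin d))))
    (ν := (volume : Measure (EuclideanSpace ℝ (Fin d))))
  have hmul := Integrable.convolution_integrand (ContinuousLinearMap.mul ℝ ℝ) hg h₁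
  simp only [ContinuousLinearMap.mul_apply'] at hmul
  have i₁ : Integrable fun p : EuclideanSpace ℝ (Fin d) × EuclideanSpace ℝ (Fin d) =>
      g p.1 * (g p.2 * w₁ (p.1 - p.2)) := by
    refine hmul.bdd_mul (c := 1) (hg.aestronglyMeasurable.comp_quasiMeasurePreserving hfst) ?_
    filter_upwards [hfst.ae hg01] with p hp
    rw [Real.norm_of_nonneg hp.1]
    exact hp.2
  have i₂ : Integrable fun p : EuclideanSpace ℝ (Fin d) × EuclideanSpace ℝ (Fin d) =>
      w₂ (p.1 - p.2) * (g p.1 * g p.2) :=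
    (hg.mul_prod hg).bdd_mul (c := lpNorm w₂ ⊤ volume)
      (h₂.aestronglyMeasurable.comp_quasiMeasurePreserving hq)
      (hq.ae (ae_le_lpNorm_exponent_top h₂))
  refine (i₁.add i₂).congr ?_
  filter_upwards [hq.ae hsum] with p hp
  simp only [Pi.add_apply, exchangeIntegrand] at hp ⊢
  rw [hp]
  ring

variable {φ : ℝ → ℝ}

/-- A set of full measure is dense, so some good point lies beyond radius `r`; there `φ` is
positive, and monotonicity carries the sign back to `r`. -/
lemma radial_profile_nonneg [NeZero d] (hpos : ∀ᵐ k, 0 < w k) (hφ : AntitoneOn φ (Set.Ioi 0))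
    (hw : ∀ᵐ k, w k = φ ‖k‖) {r : ℝ} (hr : 0 < r) : 0 ≤ φ r := by
  have hd := Measure.dense_of_ae (hpos.and hw)
  obtain ⟨k, hk, hrk⟩ := hd.exists_mem_open (U := {k | r < ‖k‖})
    (isOpen_lt continuous_const continuous_norm) (NormedSpace.exists_lt_norm ℝ _ r)
  have hrk' : r < ‖k‖ := hrk
  have h1 : 0 < w k ∧ w k = φ ‖k‖ := hk
  rw [h1.2] at h1
  exact h1.1.le.trans (hφ hr (hr.trans hrk') hrk'.le)

/-- The profile `φ`, truncated at height `n`. -/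
noncomputable def truncatedProfile (φ : ℝ → ℝ) (n : ℕ) (r : ℝ) : ℝ :=
  if r ≤ 0 then (n : ℝ) else min (φ r) n

lemma truncatedProfile_le (φ : ℝ → ℝ) (n : ℕ) (r : ℝ) : truncatedProfile φ n r ≤ n := by
  unfold truncatedProfile
  split_ifs
  exacts [le_rfl, min_le_right _ _]

lemma truncatedProfile_of_pos (φ : ℝ → ℝ) (n : ℕ) {r : ℝ} (hr : 0 < r) :
    truncatedProfile φ n r = min (φ r) n := if_neg hr.not_ge

lemma truncatedProfile_nonneg (hφ : ∀ r > 0, 0 ≤ φ r) (n : ℕ) (r : ℝ) :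
    0 ≤ truncatedProfile φ n r := by
  unfold truncatedProfile
  split_ifs with h
  exacts [n.cast_nonneg, le_min (hφ r (not_le.mp h)) n.cast_nonneg]

/-- The value on `r ≤ 0` is the cap `n` itself, so monotonicity extends to the whole line although
nothing is known of `φ` there. -/
lemma antitone_truncatedProfile (hφ : AntitoneOn φ (Set.Ioi 0)) (n : ℕ) :
    Antitone (truncatedProfile φ n) := by
  intro a b hab
  rcases le_or_gt a 0 with ha | ha
  · rw [show truncatedProfile φ n a = n from if_pos ha]
    exact truncatedProfile_le φ n b
  · rw [truncatedProfile_of_pos φ n ha, truncatedProfile_of_pos φ n (ha.trans_le hab)]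
    exact min_le_min_right _ (hφ ha (ha.trans_le hab) hab)

lemma ae_norm_pos_and_eq_profile [NeZero d] (hw : ∀ᵐ k, w k = φ ‖k‖) :
    ∀ᵐ p : EuclideanSpace ℝ (Fin d) × EuclideanSpace ℝ (Fin d),
      0 < ‖p.1 - p.2‖ ∧ w (p.1 - p.2) = φ ‖p.1 - p.2‖ := by
  have hq := quasiMeasurePreserving_sub_of_right_invariant
    (volume : Measure (EuclideanSpace ℝ (Fin d))) volume
  filter_upwards [hq.ae (hw.and (ae_norm_ne 0))] with p hp
  exact ⟨lt_of_le_of_ne (norm_nonneg _) hp.2.symm, hp.1⟩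

/-- Riesz' rearrangement inequality for a ball. -/
lemma integral_exchangeIntegrand_le [NeZero d] (hL : MemL1AddLinfty w) (hpos : ∀ᵐ k, 0 < w k)
    (hrad : IsRadialNonincreasing w) {R : ℝ} (hR : 0 ≤ R) {f : EuclideanSpace ℝ (Fin d) → ℝ}
    (hf : Integrable f) (hf01 : ∀ᵐ x, 0 ≤ f x ∧ f x ≤ 1)
    (hfR : ∫ x, f x ≤ volume.real (Metric.closedBall (0 : EuclideanSpace ℝ (Fin d)) R)) :
    ∫ p, exchangeIntegrand w f p ≤
      ∫ p, exchangeIntegrand w ((Metric.closedBall 0 R).indicator fun _ => (1 : ℝ)) p := by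
  obtain ⟨φ, hφ, hw⟩ := hrad
  have hφ0 : ∀ r > 0, 0 ≤ φ r := fun r hr => radial_profile_nonneg hpos hφ hw hr
  have hψ := antitone_truncatedProfile hφ
  have hψ0 := truncatedProfile_nonneg hφ0
  have hψN := truncatedProfile_le φ
  have hae := ae_norm_pos_and_eq_profile hw
  have hB := integrable_indicator_closedBall (E := EuclideanSpace ℝ (Fin d)) R
  have hB01 : ∀ x : EuclideanSpace ℝ (Fin d),
      0 ≤ (Metric.closedBall 0 R).indicator (fun _ => (1 : ℝ)) x ∧
      (Metric.closedBall 0 R).indicator (fun _ => (1 : ℝ)) x ≤ 1 := fun x =>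
    ⟨Set.indicator_nonneg (fun _ _ => zero_le_one) _,
      Set.indicator_le_self' (fun _ _ => zero_le_one) _⟩
  have hf0 : ∀ᵐ p : EuclideanSpace ℝ (Fin d) × EuclideanSpace ℝ (Fin d),
      0 ≤ f p.1 ∧ 0 ≤ f p.2 :=
    (Measure.quasiMeasurePreserving_fst.ae (hf01.mono fun x hx => hx.1)).and
      (Measure.quasiMeasurePreserving_snd.ae (hf01.mono fun x hx => hx.1))
  have hlim : Filter.Tendsto (fun n => interaction (truncatedProfile φ n) f f) Filter.atTop
      (nhds (∫ p, exchangeIntegrand w f p)) := by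
    refine tendsto_integral_of_dominated_convergence (exchangeIntegrand w f)
      (fun n => (integrable_interaction (hψ n) (hψ0 n) (hψN n) hf hf).aestronglyMeasurable)
      (integrable_exchangeIntegrand hL hf hf01) (fun n => ?_) ?_
    · filter_upwards [hae, hf0] with p hp hp0
      rw [Real.norm_of_nonneg (mul_nonneg (mul_nonneg (hψ0 n _) hp0.1) hp0.2), exchangeIntegrand,
        hp.2, truncatedProfile_of_pos φ n hp.1]
      exact mul_le_mul_of_nonneg_right
        (mul_le_mul_of_nonneg_right (min_le_left _ _) hp0.1) hp0.2
    · filter_upwards [hae] with p hp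
      refine tendsto_const_nhds.congr' ?_
      filter_upwards [Filter.eventually_ge_atTop ⌈φ ‖p.1 - p.2‖⌉₊] with n hn
      rw [exchangeIntegrand, hp.2, truncatedProfile_of_pos φ n hp.1,
        min_eq_left (Nat.ceil_le.mp hn)]
  -- Only the side of `f` needs a limit: for the ball, truncation simply lowers the kernel.
  refine le_of_tendsto' hlim fun n =>
    (interaction_le_interaction_indicator (hψ n) (hψ0 n) (hψN n) hR hf hf01 hfR).trans ?_
  refine integral_mono_ae (integrable_interaction (hψ n) (hψ0 n) (hψN n) hB hB)
    (integrable_exchangeIntegrand hL hB (.of_forall hB01)) ?_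
  filter_upwards [hae] with p hp
  rw [exchangeIntegrand, hp.2, truncatedProfile_of_pos φ n hp.1]
  exact mul_le_mul_of_nonneg_right
    (mul_le_mul_of_nonneg_right (min_le_left _ _) (hB01 _).1) (hB01 _).1

end Exchange

/-! ### The kinetic energy: strict bathtub principle. -/

section Kinetic

variable {E : Type*} [NormedAddCommGroup E] [InnerProductSpace ℝ E]
  [FiniteDimensional ℝ E] [MeasurableSpace E] [BorelSpace E]

lemma integrable_norm_sq_mul_indicator (R : ℝ) : Integrable fun x : E =>
    ‖x‖ ^ 2 * (Metric.closedBall 0 R).indicator (fun _ => (1 : ℝ)) x := by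
  have h : (fun x : E => ‖x‖ ^ 2 * (Metric.closedBall 0 R).indicator (fun _ => (1 : ℝ)) x) =
      (Metric.closedBall 0 R).indicator fun x => ‖x‖ ^ 2 := by
    ext x
    by_cases hx : x ∈ Metric.closedBall 0 R <;> simp [hx]
  rw [h, integrable_indicator_iff measurableSet_closedBall]
  exact ContinuousOn.integrableOn_compact (isCompact_closedBall _ _) (by fun_prop)

/-- Among the functions with values in `[0, 1]` and the same integral, the indicator function of a
centred ball is the only one of minimal second moment. -/
lemma ae_eq_indicator_of_moment_le [Nontrivial E] {R : ℝ} (hR : 0 ≤ R) {f : E → ℝ}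
    (hf : Integrable f) (hf01 : ∀ᵐ x, 0 ≤ f x ∧ f x ≤ 1)
    (hfR : ∫ x, f x = volume.real (Metric.closedBall (0 : E) R))
    (hfm : Integrable fun x => ‖x‖ ^ 2 * f x) :
    (∫ x, ‖x‖ ^ 2 * (Metric.closedBall (0 : E) R).indicator (fun _ => (1 : ℝ)) x ≤
      ∫ x, ‖x‖ ^ 2 * f x) ∧
    (∫ x, ‖x‖ ^ 2 * f x ≤
        ∫ x, ‖x‖ ^ 2 * (Metric.closedBall (0 : E) R).indicator (fun _ => (1 : ℝ)) x →
      f =ᵐ[volume] (Metric.closedBall 0 R).indicator fun _ => (1 : ℝ)) := by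
  have hB := integrable_indicator_closedBall (E := E) R
  have hBm := integrable_norm_sq_mul_indicator (E := E) R
  have hBv : ∫ x, (Metric.closedBall (0 : E) R).indicator (fun _ => (1 : ℝ)) x =
      volume.real (Metric.closedBall (0 : E) R) := by
    rw [integral_indicator measurableSet_closedBall]
    simp
  set B := (Metric.closedBall (0 : E) R).indicator fun _ => (1 : ℝ) with hBdef
  -- `R ^ 2` is the Lagrange multiplier of the mass constraint: its term integrates to zero and
  -- makes the integrand pointwise nonnegative, with equality off the sphere only where `f = B`.
  have hpt : ∀ᵐ x : E, 0 ≤ (‖x‖ ^ 2 * f x - ‖x‖ ^ 2 * B x) - R ^ 2 * (f x - B x) := by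
    filter_upwards [hf01] with x hx
    have hfac : (‖x‖ ^ 2 * f x - ‖x‖ ^ 2 * B x) - R ^ 2 * (f x - B x) =
        (‖x‖ ^ 2 - R ^ 2) * (f x - B x) := by ring
    rw [hfac]
    by_cases h : x ∈ Metric.closedBall 0 R
    · rw [hBdef, Set.indicator_of_mem h]
      have : ‖x‖ ^ 2 ≤ R ^ 2 := by
        have : ‖x‖ ≤ R := by simpa using h
        gcongr
      exact mul_nonneg_of_nonpos_of_nonpos (by linarith) (by linarith)
    · rw [hBdef, Set.indicator_of_notMem h]
      have : R ^ 2 ≤ ‖x‖ ^ 2 := by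
        have : R < ‖x‖ := by simpa using h
        gcongr
      exact mul_nonneg (by linarith) (by linarith)
  have i1 : Integrable fun x => ‖x‖ ^ 2 * f x - ‖x‖ ^ 2 * B x := hfm.sub hBm
  have i2 : Integrable fun x => R ^ 2 * (f x - B x) := (hf.sub hB).const_mul _
  have hval : ∫ x, ((‖x‖ ^ 2 * f x - ‖x‖ ^ 2 * B x) - R ^ 2 * (f x - B x)) =
      (∫ x, ‖x‖ ^ 2 * f x) - ∫ x, ‖x‖ ^ 2 * B x := by
    rw [integral_sub i1 i2, integral_const_mul, integral_sub hf hB, integral_sub hfm hBm, hfR, hBv]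
    ring
  have hnonneg := integral_nonneg_of_ae hpt
  refine ⟨by linarith, fun hle => ?_⟩
  have hz := (integral_eq_zero_iff_of_nonneg_ae hpt (i1.sub i2)).mp
    (le_antisymm (by rw [hval]; linarith) hnonneg)
  filter_upwards [hz, ae_norm_ne R] with x hx hxR
  have hfac : (‖x‖ ^ 2 - R ^ 2) * (f x - B x) = 0 := by
    rw [← show _ = (0 : ℝ) from hx]
    ring
  rcases mul_eq_zero.mp hfac with h | h
  · exact absurd ((sq_eq_sq₀ (norm_nonneg _) hR).mp (sub_eq_zero.mp h)) hxR
  · exact sub_eq_zero.mp h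

end Kinetic

/-! ### The energy, the Fermi ball and the conclusion. -/

section Energy

variable {d : ℕ}

lemma noSpinEnergy_of_integrable (w : EuclideanSpace ℝ (Fin d) → ℝ)
    {g : EuclideanSpace ℝ (Fin d) → ℝ} (hg0 : ∀ᵐ k, 0 ≤ g k)
    (hg : Integrable fun k => ‖k‖ ^ 2 * g k) :
    noSpinEnergy w g = ((1 / (2 * (2 * Real.pi) ^ d) * (∫ k, ‖k‖ ^ 2 * g k) -
      exchangeEnergy w g : ℝ) : EReal) := by
  have h0 : ∀ᵐ k, 0 ≤ ‖k‖ ^ 2 * g k := hg0.mono fun k hk => mul_nonneg (sq_nonneg _) hk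
  have hc : (0 : ℝ) ≤ 1 / (2 * (2 * Real.pi) ^ d) := by positivity
  rw [noSpinEnergy, kineticEnergy, ← ofReal_integral_eq_lintegral_ofReal hg h0,
    ← ENNReal.ofReal_mul hc, EReal.coe_ennreal_ofReal,
    max_eq_left (mul_nonneg hc (integral_nonneg_of_ae h0)), EReal.coe_sub]

lemma noSpinEnergy_of_not_integrable (w : EuclideanSpace ℝ (Fin d) → ℝ)
    {g : EuclideanSpace ℝ (Fin d) → ℝ} (hgm : AEStronglyMeasurable g) (hg0 : ∀ᵐ k, 0 ≤ g k)
    (hg : ¬ Integrable fun k => ‖k‖ ^ 2 * g k) : noSpinEnergy w g = ⊤ := by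
  have h0 : ∀ᵐ k, 0 ≤ ‖k‖ ^ 2 * g k := hg0.mono fun k hk => mul_nonneg (sq_nonneg _) hk
  have hm : AEStronglyMeasurable fun k => ‖k‖ ^ 2 * g k :=
    AEStronglyMeasurable.mul (Continuous.aestronglyMeasurable (by fun_prop)) hgm
  have hc : (0 : ℝ) < 1 / (2 * (2 * Real.pi) ^ d) := by positivity
  have htop : ∫⁻ k, ENNReal.ofReal (‖k‖ ^ 2 * g k) = ⊤ := by
    by_contra h
    exact hg ((lintegral_ofReal_ne_top_iff_integrable hm h0).mp h)
  rw [noSpinEnergy, kineticEnergy, htop, ENNReal.mul_top (ENNReal.ofReal_pos.mpr hc).ne',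
    EReal.coe_ennreal_top, EReal.top_sub_coe]

/-- The radius `2π (d / |𝕊ᵈ⁻¹|)^(1/d) ρ^(1/d)` of the Fermi ball. -/
noncomputable def fermiRadius (d : ℕ) (ρ : ℝ) : ℝ :=
  2 * Real.pi * ((d : ℝ) / sphereArea d) ^ ((1 : ℝ) / d) * ρ ^ ((1 : ℝ) / d)

lemma sphereArea_eq (d : ℕ) : sphereArea d =
    d * volume.real (Metric.ball (0 : EuclideanSpace ℝ (Fin d)) 1) := by
  rw [sphereArea, Measure.toSphere_real_apply_univ, finrank_euclideanSpace_fin]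

lemma sphereArea_nonneg (d : ℕ) : 0 ≤ sphereArea d := measureReal_nonneg

lemma fermiRadius_nonneg (d : ℕ) {ρ : ℝ} (hρ : 0 ≤ ρ) : 0 ≤ fermiRadius d ρ := by
  have := sphereArea_nonneg d
  unfold fermiRadius
  positivity

lemma fermiBall_eq_indicator (d : ℕ) {ρ : ℝ} (hρ : 0 ≤ ρ) :
    fermiBall d ρ = (Metric.closedBall 0 (fermiRadius d ρ)).indicator fun _ => (1 : ℝ) := by
  have hS : 0 ≤ (d : ℝ) / sphereArea d := div_nonneg d.cast_nonneg (sphereArea_nonneg d)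
  have hsq : ∀ x : ℝ, 0 ≤ x → x ^ ((2 : ℝ) / d) = (x ^ ((1 : ℝ) / d)) ^ 2 := fun x hx => by
    rw [← Real.rpow_natCast, ← Real.rpow_mul hx]
    congr 1
    push_cast
    ring
  have hR : thomasFermiConstant d * ρ ^ ((2 : ℝ) / d) = fermiRadius d ρ ^ 2 := by
    rw [thomasFermiConstant, fermiRadius, hsq _ hS, hsq _ hρ]
    ring
  unfold fermiBall
  congr 1
  ext k
  rw [Set.mem_ofPred_eq, mem_closedBall_zero_iff, hR,
    sq_le_sq₀ (norm_nonneg _) (fermiRadius_nonneg d hρ)]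

lemma volume_real_closedBall_fermiRadius (d : ℕ) [NeZero d] {ρ : ℝ} (hρ : 0 ≤ ρ) :
    volume.real (Metric.closedBall (0 : EuclideanSpace ℝ (Fin d)) (fermiRadius d ρ)) =
      (2 * Real.pi) ^ d * ρ := by
  have hd : (d : ℝ) ≠ 0 := NeZero.ne _
  have hS : 0 ≤ (d : ℝ) / sphereArea d := div_nonneg d.cast_nonneg (sphereArea_nonneg d)
  have hpow : ∀ x : ℝ, 0 ≤ x → (x ^ ((1 : ℝ) / d)) ^ d = x := fun x hx => by
    rw [one_div, Real.rpow_inv_natCast_pow hx (NeZero.ne d)]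
  have hb : volume.real (Metric.ball (0 : EuclideanSpace ℝ (Fin d)) 1) ≠ 0 :=
    (ENNReal.toReal_pos (Metric.measure_ball_pos _ _ one_pos).ne' measure_ball_lt_top.ne).ne'
  rw [Measure.addHaar_real_closedBall volume _ (fermiRadius_nonneg d hρ),
    finrank_euclideanSpace_fin, fermiRadius, mul_pow, mul_pow, hpow _ hS, hpow _ hρ, sphereArea_eq]
  field_simp

lemma IsNoSpinState.integral_eq {ρ : ℝ} {g : EuclideanSpace ℝ (Fin d) → ℝ}
    (hg : IsNoSpinState ρ g) : ∫ k, g k = (2 * Real.pi) ^ d * ρ := by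
  rw [← hg.density]
  have : (2 * Real.pi) ^ d ≠ 0 := by positivity
  field_simp

lemma isNoSpinState_fermiBall (d : ℕ) [NeZero d] {ρ : ℝ} (hρ : 0 ≤ ρ) :
    IsNoSpinState ρ (fermiBall d ρ) := by
  rw [fermiBall_eq_indicator d hρ]
  refine ⟨integrable_indicator_closedBall _, .of_forall fun x =>
    ⟨Set.indicator_nonneg (fun _ _ => zero_le_one) _,
      Set.indicator_le_self' (fun _ _ => zero_le_one) _⟩, ?_⟩
  have h : ∫ x, (Metric.closedBall (0 : EuclideanSpace ℝ (Fin d)) (fermiRadius d ρ)).indicator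
      (fun _ => (1 : ℝ)) x = (2 * Real.pi) ^ d * ρ := by
    rw [integral_indicator measurableSet_closedBall, ← volume_real_closedBall_fermiRadius d hρ]
    simp
  rw [h]
  have : (2 * Real.pi) ^ d ≠ 0 := by positivity
  field_simp

/-- The comparison of the energy of a state with that of the Fermi ball. -/
lemma noSpinEnergy_fermiBall_le [NeZero d] {w : EuclideanSpace ℝ (Fin d) → ℝ}
    (hw : MemL1AddLinfty w) (hpos : ∀ᵐ k, 0 < w k) (hrad : IsRadialNonincreasing w)
    {ρ : ℝ} (hρ : 0 ≤ ρ) {g : EuclideanSpace ℝ (Fin d) → ℝ} (hg : IsNoSpinState ρ g) :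
    noSpinEnergy w (fermiBall d ρ) ≤ noSpinEnergy w g ∧
      (noSpinEnergy w g ≤ noSpinEnergy w (fermiBall d ρ) → g =ᵐ[volume] fermiBall d ρ) := by
  have hR := fermiRadius_nonneg d hρ
  have hgR : ∫ k, g k =
      volume.real (Metric.closedBall (0 : EuclideanSpace ℝ (Fin d)) (fermiRadius d ρ)) := by
    rw [hg.integral_eq, volume_real_closedBall_fermiRadius d hρ]
  have hg0 : ∀ᵐ k, 0 ≤ g k := hg.bounds.mono fun k hk => hk.1
  rw [fermiBall_eq_indicator d hρ, noSpinEnergy_of_integrable w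
    (.of_forall fun x => Set.indicator_nonneg (fun _ _ => zero_le_one) _)
    (integrable_norm_sq_mul_indicator _)]
  by_cases hgm : Integrable fun k => ‖k‖ ^ 2 * g k
  · have hex : exchangeEnergy w g ≤ exchangeEnergy w
        ((Metric.closedBall 0 (fermiRadius d ρ)).indicator fun _ => (1 : ℝ)) :=
      mul_le_mul_of_nonneg_left
        (integral_exchangeIntegrand_le hw hpos hrad hR hg.integrable hg.bounds hgR.le)
        (by positivity)
    have hc : (0 : ℝ) < 1 / (2 * (2 * Real.pi) ^ d) := by positivity
    obtain ⟨hle, heq⟩ := ae_eq_indicator_of_moment_le hR hg.integrable hg.bounds hgR hgm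
    rw [noSpinEnergy_of_integrable w hg0 hgm, EReal.coe_le_coe_iff, EReal.coe_le_coe_iff]
    -- If the energy of `g` is no larger, the exchange inequality leaves its moment no larger than
    -- the ball's, which is the equality case of the bathtub principle.
    refine ⟨sub_le_sub (mul_le_mul_of_nonneg_left hle hc.le) hex, fun h => heq ?_⟩
    exact le_of_mul_le_mul_left (by linarith) hc
  · rw [noSpinEnergy_of_not_integrable w hg.integrable.aestronglyMeasurable hg0 hgm]
    exact ⟨le_top, fun h => absurd h (not_le.mpr (EReal.coe_lt_top _))⟩

end Energy

theorem theorem2 (d : ℕ) (hd : 1 ≤ d) (w : EuclideanSpace ℝ (Fin d) → ℝ)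
    (hw : MemL1AddLinfty w) (hpos : ∀ᵐ k ∂volume, 0 < w k) (hrad : IsRadialNonincreasing w)
    (ρ : ℝ) (hρ : 0 ≤ ρ) :
    -- the energy of every state is well defined
    (∀ g : EuclideanSpace ℝ (Fin d) → ℝ, IsNoSpinState ρ g →
      Integrable (exchangeIntegrand w g) volume) ∧
    -- existence and uniqueness, as an element of `L¹`, of the minimiser
    IsNoSpinMinimiser w ρ (fermiBall d ρ) ∧
    ∀ g : EuclideanSpace ℝ (Fin d) → ℝ, IsNoSpinMinimiser w ρ g → g =ᵐ[volume] fermiBall d ρ := by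
  have : NeZero d := ⟨by omega⟩
  have hB := isNoSpinState_fermiBall d hρ
  exact ⟨fun g hg => integrable_exchangeIntegrand hw hg.integrable hg.bounds,
    ⟨hB, fun f hf => (noSpinEnergy_fermiBall_le hw hpos hrad hρ hf).1⟩,
    fun g hg => (noSpinEnergy_fermiBall_le hw hpos hrad hρ hg.1).2 (hg.2 _ hB)⟩
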